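/- **Schemes.** Let $L$ be a relational signature. An $L$-scheme $\tau(P)$ is a sentence of $L\cup\{P\}$, where $P$ is an extra $k$-ary predicate; a sentence of $L$ counts as a scheme in which $P$ does not occur. Let $T$ be a collection of $L'$-schemes. A pair $(\mathcal M,\mathcal X)$, with $\mathcal M$ an $L'$-structure and $\mathcal X$ a family of finitary relations ("classes") on its universe $M$, is a model of $\mathsf{sPC}(T)$ if (i) every relation on $M$ that is first-order definable in $\mathcal M$ expanded by finitely many classes from $\mathcal X$, without quantification over classes and without first-order parameters, belongs to $\mathcal X$; and (ii) $(\mathcal M,P)\models\sigma(P)$ for every $\sigma\in T$ and every $P\in\mathcal X$ of the right arity. **Strong models.** An $L$-structure $\mathcal N\in\mathcal X$ consists of a nonempty domain $N\subseteq M$, an equality relation $=^{\mathcal N}$ (an equivalence relation on $N$, not necessarily that of $\mathcal M$) and relations interpreting the symbols of $L$, for which $=^{\mathcal N}$ is a congruence; all of these belong to $\mathcal X$. It is an $\mathcal X$-strong model of $\tau$ if $(\mathcal N,P)\models\tau(P)$ for every $=^{\mathcal N}$-invariant class $P\in\mathcal X$ (restricted to $N$), equality being interpreted as $=^{\mathcal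 N}$. The scheme $\tau$ is *standalone complete in $T$* if for every $(\mathcal M,\mathcal X)\models\mathsf{sPC}(T)$ any two $\mathcal X$-strong models $\mathcal N_0,\mathcal N_1\in\mathcal X$ of $\tau$ satisfy the same first-order $L$-sentences. **Adjunctive set theory** $\mathsf{AS}$ is the theory in $\{\in\}$ with the axioms $\exists x\forall y\,(y\notin x)$ and $\forall x\forall y\exists z\forall w\,(w\in z\leftrightarrow w\in x\vee w=y)$ (no extensionality). **The scheme $\mathsf{HF}(T)$.** For a finite theory $T$ in a finite relational signature $L_T$, $\mathsf{HF}(T)$ is the scheme in $L_T\cup\{\in,A\}$ that is the conjunction of: 1. replacement, with a parameter: for all $p,a$, if $P(p,\cdot,\cdot)$ is functional on $a$ (for every $x\in a$ there is at most one $y$ with $P(p,x,y)$), then there is $b$ with $\forall y\,(y\in b\leftrightarrow\exists x\in a\,P(p,x,y))$; 2. $\in$-induction, with parameters: for all $p,q$, if $\forall x\,\bigl((\forall y\in x\,P(p,q,y))\to P(p,q,x)\bigr)$, then $\forall x\,P(p,q,x)$; 3. $\forall x\exists y\forall z\,\bigl(z\in y\leftrightarrow\neg A(z)\wedge\forall w\,(w\in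 z\to w\in x)\bigr)$; 4. $\forall x\exists y\,\bigl(\neg A(y)\wedge\forall z\,(z\in y\leftrightarrow\exists w\in x\; z\in w)\bigr)$; 5. for every $x$ with $\neg A(x)$ there are a natural number $n$ and a bijection $f:n\to x$, where $f$ is a set of Kuratowski pairs and a natural number is a transitive set of transitive sets such that it and each of its elements is empty or of the form $k\cup\{k\}$; 6. extensionality for elements satisfying $\neg A$; 7. $\forall x\,(A(x)\to\forall y\; y\notin x)$; 8. the axioms of $T$ relativised to $A$, together with: each relation of $L_T$ holds only between elements of $A$. $\mathrm{DLO}$ is the theory, in the signature $\{<\}$, of nonempty (strict) dense linear orders without endpoints. **Theorem.** The scheme $\tau=\mathsf{HF}(\mathrm{DLO})$ is standalone complete in $\mathsf{AS}$. -/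

import Mathlib

universe u

namespace SchemeDef

open FirstOrder FirstOrder.Language

/-! ## Schemes -/

/-- The relation symbols of the signature with a single predicate, of arity `k`. -/
inductive PredRel (k : ℕ) : ℕ → Type
  | pred : PredRel k k

/-- The signature with a single predicate `P`, of arity `k`. -/
def predLang (k : ℕ) : FirstOrder.Language.{0, 0} := ⟨fun _ => Empty, PredRel k⟩

/-- The predicate `P`. -/
def predS (k : ℕ) : (predLang k).Relations k := PredRel.pred

/-- The interpretation of `P` given by a set of `k`-tuples. -/
@[reducible] def predStructure {k : ℕ} {M : Type*} (P : Set (Fin k → M)) :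
    (predLang k).Structure M where
  funMap := fun f => nomatch f
  RelMap := fun R v => match R, v with
    | PredRel.pred, v => v ∈ P

/-- An `L`-scheme `τ(P)`: a sentence in `L` together with one extra predicate `P`. -/
structure Scheme (L : FirstOrder.Language.{0, 0}) where
  arity : ℕ
  template : (L.sum (predLang arity)).Sentence

/-- `(M, P) ⊨ τ(P)`. -/
def Scheme.Holds {L : FirstOrder.Language.{0, 0}} (τ : Scheme L) (M : Type u) [L.Structure M]
    (P : Set (Fin τ.arity → M)) : Prop :=
  letI := predStructure P
  M ⊨ τ.template

/-- A sentence, seen as a scheme in which `P` does not occur. -/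
def Scheme.ofSentence {L : FirstOrder.Language.{0, 0}} (φ : L.Sentence) : Scheme L where
  arity := 0
  template := LHom.sumInl.onSentence φ

/-! ## Standalone predicative comprehension -/

/-- A family `X` of classes (relations of every finite arity) over `M`. -/
abbrev Classes (M : Type u) : Type u := ∀ n : ℕ, Set (Set (Fin n → M))

/-- The signature having each class in `X` as a relation symbol (a class parameter). -/
def classLang {M : Type u} (X : Classes M) : FirstOrder.Language.{0, u} :=
  ⟨fun _ => Empty, fun n => {S : Set (Fin n → M) // S ∈ X n}⟩

/-- Each class parameter denotes itself. -/
instance classStructure {M : Type u} (X : Classes M) : (classLang X).Structure M where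
  funMap := fun f => nomatch f
  RelMap := fun R v => v ∈ R.1

/-- `(M, X)` is a model of `sPC(T)`, for a collection `T` of `L`-schemes: every relation on `M`
that is first-order definable from classes in `X` (no quantification over classes, no
first-order parameters) is in `X`, and all schemes in `T` hold of all classes in `X`. -/
structure IsSPCModel {L : FirstOrder.Language.{0, 0}} (T : Set (Scheme L)) (M : Type u) [L.Structure M]
    (X : Classes M) : Prop where
  comprehension : ∀ (n : ℕ) (φ : (L.sum (classLang X)).Formula (Fin n)),
    {v : Fin n → M | φ.Realize v} ∈ X n
  schemes : ∀ τ ∈ T, ∀ P ∈ X τ.arity, τ.Holds M P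

/-! ## Strong models inside `(M, X)` and standalone completeness -/

/-- An `L`-structure `N ∈ X`, for a relational signature `L`: its domain, its equality
relation and its relations are in `X`. The equality need not be that of `M`, but it is a
congruence on `N`. -/
structure InternalStructure (L : FirstOrder.Language.{0, 0}) {M : Type u} (X : Classes M) where
  dom : Set M
  eqv : M → M → Prop
  rel : ∀ {n : ℕ}, L.Relations n → Set (Fin n → M)
  dom_mem : {v : Fin 1 → M | v 0 ∈ dom} ∈ X 1
  eqv_mem : {v : Fin 2 → M | eqv (v 0) (v 1)} ∈ X 2
  rel_mem : ∀ {n : ℕ} (R : L.Relations n), rel R ∈ X n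
  dom_nonempty : dom.Nonempty
  refl : ∀ a ∈ dom, eqv a a
  symm : ∀ a ∈ dom, ∀ b ∈ dom, eqv a b → eqv b a
  trans : ∀ a ∈ dom, ∀ b ∈ dom, ∀ c ∈ dom, eqv a b → eqv b c → eqv a c
  congr : ∀ {n : ℕ} (R : L.Relations n) (v w : Fin n → M), (∀ i, v i ∈ dom) →
    (∀ i, w i ∈ dom) → (∀ i, eqv (v i) (w i)) → v ∈ rel R → w ∈ rel R

namespace InternalStructure

variable {L : FirstOrder.Language.{0, 0}} {M : Type u} {X : Classes M} (N : InternalStructure L X)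

/-- The equality of `N` as an equivalence relation on the domain of `N`. -/
def setoid : Setoid N.dom where
  r a b := N.eqv a b
  iseqv :=
    { refl := fun a => N.refl a a.2
      symm := fun {a b} => N.symm a a.2 b b.2
      trans := fun {a b c} => N.trans a a.2 b b.2 c c.2 }

/-- The universe of `N` as an ordinary structure: elements of the domain, up to the equality
of `N`. -/
def Carrier : Type u := Quotient N.setoid

/-- The relation on the universe of `N` induced by a relation on `M`. -/
def induced {n : ℕ} (S : Set (Fin n → M)) : Set (Fin n → N.Carrier) :=
  {v | ∃ w : Fin n → N.dom, (∀ i, Quotient.mk N.setoid (w i) = v i) ∧ (fun i => (w i : M)) ∈ S}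

instance [L.IsRelational] : L.Structure N.Carrier where
  funMap := fun f => isEmptyElim f
  RelMap := fun R v => v ∈ N.induced (N.rel R)

/-- A set of tuples is invariant under the equality of `N`. -/
def Invariant {n : ℕ} (S : Set (Fin n → M)) : Prop :=
  ∀ v w : Fin n → M, (∀ i, v i ∈ N.dom) → (∀ i, w i ∈ N.dom) →
    (∀ i, N.eqv (v i) (w i)) → v ∈ S → w ∈ S

/-- `N` is an `X`-strong model of `τ`: `(N, P) ⊨ τ(P)` for every class `P ∈ X` that is invariant
under the equality of `N`. -/
def Strong [L.IsRelational] (τ : Scheme L) : Prop :=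
  ∀ P ∈ X τ.arity, N.Invariant P → τ.Holds N.Carrier (N.induced P)

end InternalStructure

/-- `τ` is standalone complete in `T`: whenever `(M, X) ⊨ sPC(T)`, any two `X`-strong models
`N₀, N₁ ∈ X` of `τ` are elementarily equivalent. -/
def StandaloneComplete {L L' : FirstOrder.Language.{0, 0}} [L.IsRelational] (τ : Scheme L)
    (T : Set (Scheme L')) : Prop :=
  ∀ (M : Type u) [Nonempty M] [L'.Structure M] (X : Classes M), IsSPCModel T M X →
    ∀ N₀ N₁ : InternalStructure L X, N₀.Strong τ → N₁.Strong τ → N₀.Carrier ≅[L] N₁.Carrier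

/-! ## Formulas of set theory

In `K.BoundedFormula Empty n` the free variables are numbered by `Fin n`; a quantifier binds the
variable `n` of the formula behind it, so a variable keeps its number below quantifiers. -/

section Formulas

variable {K : FirstOrder.Language.{0, 0}} (E : K.Relations 2) (A : K.Relations 1) {n : ℕ}

/-- `xᵢ = xⱼ` -/
def eqF (i j : Fin n) : K.BoundedFormula Empty n :=
  Term.bdEqual (Term.var (Sum.inr i)) (Term.var (Sum.inr j))

/-- `xᵢ E xⱼ`, for a binary relation symbol `E` (membership or an order) -/
def relF (i j : Fin n) : K.BoundedFormula Empty n :=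
  E.boundedFormula ![Term.var (Sum.inr i), Term.var (Sum.inr j)]

/-- `A(xᵢ)` -/
def atomF (i : Fin n) : K.BoundedFormula Empty n :=
  A.boundedFormula ![Term.var (Sum.inr i)]

/-- `x_u = {xᵢ, xⱼ}` -/
def isPairF (v i j : Fin n) : K.BoundedFormula Empty n :=
  ∼(atomF A v) ⊓
  ∀' ((relF E (Fin.last n) v.castSucc).iff
    (eqF (Fin.last n) i.castSucc ⊔ eqF (Fin.last n) j.castSucc))

/-- `x_p = ⟨xᵢ, xⱼ⟩ = {{xᵢ}, {xᵢ, xⱼ}}` -/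
def isOrdPairF (p i j : Fin n) : K.BoundedFormula Empty n :=
  ∼(atomF A p) ⊓
  ∀' ((relF E (Fin.last n) p.castSucc).iff
    (isPairF E A (Fin.last n) i.castSucc i.castSucc ⊔
      isPairF E A (Fin.last n) i.castSucc j.castSucc))

/-- `⟨xᵢ, xⱼ⟩ ∈ x_f` -/
def ordPairMemF (f i j : Fin n) : K.BoundedFormula Empty n :=
  ∃' (relF E (Fin.last n) f.castSucc ⊓ isOrdPairF E A (Fin.last n) i.castSucc j.castSucc)

/-- `xᵢ` is a set, and it is empty or it is `y ∪ {y}` for some `y` -/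
def zeroOrSuccF (i : Fin n) : K.BoundedFormula Empty n :=
  ∼(atomF A i) ⊓
  ((∀' ∼(relF E (Fin.last n) i.castSucc)) ⊔
  (∃' ∀' ((relF E (Fin.last (n + 1)) i.castSucc.castSucc).iff
    (relF E (Fin.last (n + 1)) (Fin.last n).castSucc ⊔
      eqF (Fin.last (n + 1)) (Fin.last n).castSucc))))

/-- `xᵢ` is transitive: elements of its elements are its elements -/
def transF (i : Fin n) : K.BoundedFormula Empty n :=
  ∀' ∀' ((relF E (Fin.last n).castSucc i.castSucc.castSucc).imp
    ((relF E (Fin.last (n + 1)) (Fin.last n).castSucc).imp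
      (relF E (Fin.last (n + 1)) i.castSucc.castSucc)))

/-- `xᵢ` is a natural number: a transitive set of transitive sets such that it and each of its
elements is zero or a successor -/
def isNatF (i : Fin n) : K.BoundedFormula Empty n :=
  transF E i ⊓ zeroOrSuccF E A i ⊓
  ∀' ((relF E (Fin.last n) i.castSucc).imp
    (transF E (Fin.last n) ⊓ zeroOrSuccF E A (Fin.last n)))

/-- `x_f` is a bijection `x_m → xᵢ` -/
def isBijF (f m i : Fin n) : K.BoundedFormula Empty n :=
  ∼(atomF A f) ⊓
  (∀' ((relF E (Fin.last n) f.castSucc).imp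
    (∃' ∃' (relF E (Fin.last (n + 1)).castSucc m.castSucc.castSucc.castSucc ⊓
      relF E (Fin.last (n + 2)) i.castSucc.castSucc.castSucc ⊓
      isOrdPairF E A (Fin.last n).castSucc.castSucc (Fin.last (n + 1)).castSucc
        (Fin.last (n + 2)))))) ⊓
  (∀' ((relF E (Fin.last n) m.castSucc).imp
    (∃' (ordPairMemF E A f.castSucc.castSucc (Fin.last n).castSucc (Fin.last (n + 1)) ⊓
      ∀' ((ordPairMemF E A f.castSucc.castSucc.castSucc (Fin.last n).castSucc.castSucc
          (Fin.last (n + 2))).imp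
        (eqF (Fin.last (n + 2)) (Fin.last (n + 1)).castSucc)))))) ⊓
  (∀' ((relF E (Fin.last n) i.castSucc).imp
    (∃' (ordPairMemF E A f.castSucc.castSucc (Fin.last (n + 1)) (Fin.last n).castSucc ⊓
      ∀' ((ordPairMemF E A f.castSucc.castSucc.castSucc (Fin.last (n + 2))
          (Fin.last n).castSucc.castSucc).imp
        (eqF (Fin.last (n + 2)) (Fin.last (n + 1)).castSucc))))))

end Formulas

/-! ## Adjunctive set theory -/

/-- The relation symbols of set theory. -/
inductive SetRel : ℕ → Type
  | mem : SetRel 2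

/-- The signature `{∈}`. -/
def setLang : FirstOrder.Language.{0, 0} := ⟨fun _ => Empty, SetRel⟩

/-- The symbol `∈` of set theory. -/
def setMem : setLang.Relations 2 := SetRel.mem

/-- `∃ x₀ ∀ x₁, x₁ ∉ x₀` -/
def emptySetAx : setLang.Sentence :=
  ∃' ∀' ∼(relF setMem (1 : Fin 2) 0)

/-- `∀ x₀ x₁ ∃ x₂ ∀ x₃, x₃ ∈ x₂ ↔ x₃ ∈ x₀ ∨ x₃ = x₁` -/
def adjunctionAx : setLang.Sentence :=
  ∀' ∀' ∃' ∀' ((relF setMem (3 : Fin 4) 2).iff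
    (relF setMem (3 : Fin 4) 0 ⊔ eqF 3 1))

/-- Adjunctive set theory `AS`: empty set and adjunction (no extensionality). -/
def adjunctiveSetTheory : Set (Scheme setLang) :=
  {Scheme.ofSentence emptySetAx, Scheme.ofSentence adjunctionAx}

/-! ## The scheme `HF(T)` -/

/-- The symbols `∈` and `A`. -/
inductive HFRel : ℕ → Type
  | mem : HFRel 2
  | atom : HFRel 1

/-- The signature `{∈, A}`. -/
def hfLang : FirstOrder.Language.{0, 0} := ⟨fun _ => Empty, HFRel⟩

/-- The symbol `∈`. -/
def hfMem : hfLang.Relations 2 := HFRel.mem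

/-- The symbol `A`. -/
def hfAtom : hfLang.Relations 1 := HFRel.atom

instance : hfLang.IsRelational := fun _ => inferInstanceAs (IsEmpty Empty)

section HF

variable {L : FirstOrder.Language.{0, 0}}

/-- Relativisation of a formula to the predicate `A`, along an inclusion of signatures. -/
def relativize {K : FirstOrder.Language.{0, 0}} (ι : L →ᴸ K) (A : K.Relations 1) :
    ∀ {n : ℕ}, L.BoundedFormula Empty n → K.BoundedFormula Empty n
  | _, .falsum => .falsum
  | _, .equal s t => .equal (ι.onTerm s) (ι.onTerm t)
  | _, .rel R ts => .rel (ι.onRelation R) (fun i => ι.onTerm (ts i))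
  | _, .imp φ ψ => .imp (relativize ι A φ) (relativize ι A ψ)
  | n, .all φ => .all ((atomF A (Fin.last n)).imp (relativize ι A φ))

/-- Membership in `L ∪ {∈, A}`. -/
def memS : (L.sum hfLang).Relations 2 := Sum.inr hfMem

/-- The atom predicate in `L ∪ {∈, A}`. -/
def atomS : (L.sum hfLang).Relations 1 := Sum.inr hfAtom

/-- `∀ x₀ ∃ x₁ ∀ x₂, x₂ ∈ x₁ ↔ ¬ A(x₂) ∧ ∀ x₃ (x₃ ∈ x₂ → x₃ ∈ x₀)` -/
def powersetAx : (L.sum hfLang).Sentence :=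
  ∀' ∃' ∀' ((relF memS (2 : Fin 3) 1).iff
    (∼(atomF atomS (2 : Fin 3)) ⊓ ∀' ((relF memS (3 : Fin 4) 2).imp (relF memS (3 : Fin 4) 0))))

/-- `∀ x₀ ∃ x₁, ¬ A(x₁) ∧ ∀ x₂ (x₂ ∈ x₁ ↔ ∃ x₃ (x₃ ∈ x₀ ∧ x₂ ∈ x₃))` -/
def unionAx : (L.sum hfLang).Sentence :=
  ∀' ∃' (∼(atomF atomS (1 : Fin 2)) ⊓ ∀' ((relF memS (2 : Fin 3) 1).iff
    (∃' (relF memS (3 : Fin 4) 0 ⊓ relF memS (2 : Fin 4) 3))))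

/-- Every set `x₀` is the image of a bijection `x₂` from a natural number `x₁`. -/
def finiteAx : (L.sum hfLang).Sentence :=
  ∀' ((∼(atomF atomS (0 : Fin 1))).imp
    (∃' ∃' (isNatF memS atomS (1 : Fin 3) ⊓ isBijF memS atomS (2 : Fin 3) 1 0)))

/-- Extensionality for non-atoms. -/
def extAx : (L.sum hfLang).Sentence :=
  ∀' ∀' ((∼(atomF atomS (0 : Fin 2))).imp ((∼(atomF atomS (1 : Fin 2))).imp
    ((∀' ((relF memS (2 : Fin 3) 0).iff (relF memS (2 : Fin 3) 1))).imp (eqF 0 1))))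

/-- Atoms have no elements. -/
def atomAx : (L.sum hfLang).Sentence :=
  ∀' ((atomF atomS (0 : Fin 1)).imp (∀' ∼(relF memS (1 : Fin 2) 0)))

/-- The relations of `L` hold between atoms only: `R(x̄) → ⋀ᵢ A(xᵢ)` for each `R` in `L`. -/
noncomputable def confinedAx [Finite (Σ n, L.Relations n)] : (L.sum hfLang).Sentence :=
  BoundedFormula.iInf fun R : Σ n, L.Relations n =>
    (((LHom.sumInl.onRelation R.2 : (L.sum hfLang).Relations R.1).boundedFormula
        (α := Empty) fun i : Fin R.1 => Term.var (Sum.inr i)).imp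
      (BoundedFormula.iInf fun i : Fin R.1 => atomF atomS i)).alls

/-- The axioms of `T`, relativised to `A`. -/
noncomputable def relativizedAx (T : L.Theory) [Finite T] : (L.sum hfLang).Sentence :=
  BoundedFormula.iInf fun φ : T => relativize LHom.sumInl atomS φ.1

/-- The ternary predicate `P` in `K ∪ {P}`. -/
def predP {K : FirstOrder.Language.{0, 0}} : (K.sum (predLang 3)).Relations 3 := Sum.inr (predS 3)

/-- `P(xᵢ, xⱼ, xₖ)`, for the predicate `P` of a scheme with a ternary predicate. -/
def predF {K : FirstOrder.Language.{0, 0}} {n : ℕ} (i j k : Fin n) :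
    (K.sum (predLang 3)).BoundedFormula Empty n :=
  predP.boundedFormula
    ![Term.var (Sum.inr i), Term.var (Sum.inr j), Term.var (Sum.inr k)]

/-- Membership in `L ∪ {∈, A} ∪ {P}`. -/
def memP : ((L.sum hfLang).sum (predLang 3)).Relations 2 := Sum.inl memS

/-- The replacement scheme, where `x₀` is a parameter: if `P(x₀, ·, ·)` is functional on `x₁`,
then there is `x₂` whose elements are the `x₃` with `P(x₀, x₄, x₃)` for some `x₄ ∈ x₁`. -/
def replScheme : ((L.sum hfLang).sum (predLang 3)).Sentence :=
  ∀' ∀' ((∀' ((relF memP (2 : Fin 3) 1).imp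
      (∀' ∀' ((predF (0 : Fin 5) 2 3).imp ((predF (0 : Fin 5) 2 4).imp (eqF 3 4)))))).imp
    (∃' ∀' ((relF memP (3 : Fin 4) 2).iff
      (∃' (relF memP (4 : Fin 5) 1 ⊓ predF (0 : Fin 5) 4 3)))))

/-- The scheme of `∈`-induction, where `x₀`, `x₁` are parameters: if
`∀ x₂ ((∀ x₃ ∈ x₂, P(x₀, x₁, x₃)) → P(x₀, x₁, x₂))` then `∀ x₂, P(x₀, x₁, x₂)`. -/
def inductionScheme : ((L.sum hfLang).sum (predLang 3)).Sentence :=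
  ∀' ∀' ((∀' ((∀' ((relF memP (3 : Fin 4) 2).imp (predF (0 : Fin 4) 1 3))).imp
      (predF (0 : Fin 3) 1 2))).imp
    (∀' (predF (0 : Fin 3) 1 2)))

/-- The scheme `HF(T)`, for a finite theory `T` in a finite relational signature `L`, in the
signature `L ∪ {∈, A}`. -/
noncomputable def hf (T : L.Theory) [Finite T] [Finite (Σ n, L.Relations n)] :
    Scheme (L.sum hfLang) where
  arity := 3
  template := replScheme ⊓ inductionScheme ⊓
    LHom.sumInl.onSentence (powersetAx ⊓ unionAx ⊓ finiteAx ⊓ extAx ⊓ atomAx ⊓ confinedAx ⊓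
      relativizedAx T)

end HF

/-! ## Dense linear orders without endpoints -/

/-- The relation symbols of strict orders. -/
inductive OrdRel : ℕ → Type
  | lt : OrdRel 2

/-- The signature `{<}`. -/
def ordLang : FirstOrder.Language.{0, 0} := ⟨fun _ => Empty, OrdRel⟩

/-- The symbol `<`. -/
def ordLt : ordLang.Relations 2 := OrdRel.lt

instance : ordLang.IsRelational := fun _ => inferInstanceAs (IsEmpty Empty)

instance : Finite (Σ n, ordLang.Relations n) := by
  refine Finite.of_surjective (fun _ : Unit => ⟨2, ordLt⟩) ?_
  rintro ⟨n, R⟩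
  cases R
  exact ⟨(), rfl⟩

/-- `xᵢ < xⱼ` -/
def ltF {n : ℕ} (i j : Fin n) : ordLang.BoundedFormula Empty n :=
  relF ordLt i j

/-- The theory of (nonempty) dense linear orders without endpoints. -/
def DLO : ordLang.Theory :=
  { ∃' (eqF (0 : Fin 1) 0),
    ∀' ∼(ltF (0 : Fin 1) 0),
    ∀' ∀' ∀' ((ltF (0 : Fin 3) 1).imp ((ltF (1 : Fin 3) 2).imp (ltF (0 : Fin 3) 2))),
    ∀' ∀' (ltF (0 : Fin 2) 1 ⊔ eqF (0 : Fin 2) 1 ⊔ ltF (1 : Fin 2) 0),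
    ∀' ∀' ((ltF (0 : Fin 2) 1).imp (∃' (ltF (0 : Fin 3) 2 ⊓ ltF (2 : Fin 3) 1))),
    ∀' ∃' (ltF (0 : Fin 2) 1),
    ∀' ∃' (ltF (1 : Fin 2) 0) }

instance : Finite DLO := by
  unfold DLO
  exact Set.toFinite _

end SchemeDef

/-! The proof is a back-and-forth argument between two strong models `N₀` and `N₁`. Neither model
need be standard: their natural numbers may be nonstandard and different, so an extension by one
element may require a number of steps that is infinite from outside. The argument must therefore be
an induction carried out inside a model, and the induction hypothesis must be a definable predicate.

Extendibility involves a quantifier over partial isomorphisms, whereas comprehension forbids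
quantifiers over classes. This is where `AS` enters. An element `m` of `M` codes the relation
consisting of those pairs whose representatives form a Kuratowski pair belonging to `m`. Empty set
and adjunction give a code of the empty relation and allow one pair to be added to a coded relation
(`isRelCode_codedRel`). Quantification over coded relations is first-order, so "every coded partial
isomorphism extends to a coded one with `c` in its domain" is definable. Comprehension makes it an
invariant class of `N₀`, to which the induction scheme of `N₀` applies
(`InternalStructure.Strong.isHF`).

The finiteness axiom and `∈`-induction give induction along atoms, the empty set and the adjunction
of an element (`IsHF.hf_ind`). The partial isomorphisms considered have transitive domains and
ranges that are sets of the respective models (`IsPIso`). For an atom `c`, the domain has a largest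
atom below `c` and a smallest above it, if there are any, because it is finite in the sense of `N₀`;
density and the lack of endpoints in `N₁` then supply an image (`IsPIso.extend_atom`). For `c = a ∪
{x}`, the map is extended to `a` and to `x`, with images `b` and `y`, and `c` is sent to `b ∪ {y}`
(`IsRelCode.forth`). The converse relations give the other direction. Only the concluding induction
on formulas takes place outside the models. -/

namespace SchemeDef

open FirstOrder FirstOrder.Language

/-! ## Definable predicates on interpreted sorts -/

section Definability

variable {K : FirstOrder.Language.{0, u}} {M : Type u} [K.Structure M]

variable (K M) in
/-- A sort interpreted in `M`: its elements are coded by tuples from `M`, and it is definable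
when two tuples code the same element. -/
class Coded (S : Type u) where
  ι : Type
  finite : Finite ι
  code : (ι → M) → S → Prop
  functional : ∀ {v s t}, code v s → code v t → s = t
  surj : ∀ s, ∃ v, code v s
  eq_definable : (∅ : Set M).Definable K {v : ι ⊕ ι → M | ∃ s, code (v ∘ Sum.inl) s ∧ code (v ∘ Sum.inr) s}

attribute [instance] Coded.finite

variable {S T Γ Δ : Type u} [Coded K M S] [Coded K M T] [Coded K M Γ] [Coded K M Δ]

variable (K M) in
/-- A predicate on an interpreted sort is definable if its set of codes is. -/
def Dfn {S : Type u} [Coded K M S] (P : S → Prop) : Prop :=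
  (∅ : Set M).Definable K {v : Coded.ι K M S → M | ∃ s, Coded.code (K := K) v s ∧ P s}

instance Coded.self : Coded K M M where
  ι := Unit
  finite := inferInstance
  code v s := v () = s
  functional := by rintro v s t rfl rfl; rfl
  surj s := ⟨fun _ => s, rfl⟩
  eq_definable := by
    refine Set.empty_definable_iff.2
      ⟨(Term.var (Sum.inl ())).equal (Term.var (Sum.inr ())), ?_⟩
    ext v
    simp [eq_comm]

instance Coded.prod : Coded K M (S × T) where
  ι := Coded.ι K M S ⊕ Coded.ι K M T
  finite := inferInstance
  code v p := Coded.code (K := K) (v ∘ Sum.inl) p.1 ∧ Coded.code (K := K) (v ∘ Sum.inr) p.2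
  functional := fun h h' => Prod.ext (Coded.functional h.1 h'.1) (Coded.functional h.2 h'.2)
  surj p := by
    obtain ⟨v, hv⟩ := Coded.surj (K := K) (M := M) p.1
    obtain ⟨w, hw⟩ := Coded.surj (K := K) (M := M) p.2
    exact ⟨Sum.elim v w, hv, hw⟩
  eq_definable := by
    convert ((Coded.eq_definable (K := K) (M := M) (S := S)).preimage_comp
      (Sum.map Sum.inl Sum.inl)).inter ((Coded.eq_definable (K := K) (M := M)
        (S := T)).preimage_comp (Sum.map Sum.inr Sum.inr)) using 1
    ext v
    constructor
    · rintro ⟨p, ⟨h1, h2⟩, h3, h4⟩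
      exact ⟨⟨p.1, h1, h3⟩, p.2, h2, h4⟩
    · rintro ⟨⟨s, h1, h3⟩, t, h2, h4⟩
      exact ⟨(s, t), ⟨h1, h2⟩, h3, h4⟩

variable (K M) in
/-- A map between interpreted sorts that only selects components of codes. -/
def Tm {Γ S : Type u} [Coded K M Γ] [Coded K M S] (f : Γ → S) : Prop :=
  ∃ e : Coded.ι K M S → Coded.ι K M Γ, ∀ (v : Coded.ι K M Γ → M) (γ : Γ),
    Coded.code (K := K) v γ → Coded.code (K := K) (v ∘ e) (f γ)

theorem Tm.id : Tm K M (fun s : S => s) := ⟨_root_.id, fun _ _ h => h⟩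

theorem Tm.fst {f : Γ → S × T} (h : Tm K M f) : Tm K M (fun γ => (f γ).1) := by
  obtain ⟨e, he⟩ := h
  exact ⟨e ∘ Sum.inl, fun v p hv => (he _ _ hv).1⟩

theorem Tm.snd {f : Γ → S × T} (h : Tm K M f) : Tm K M (fun γ => (f γ).2) := by
  obtain ⟨e, he⟩ := h
  exact ⟨e ∘ Sum.inr, fun v p hv => (he _ _ hv).2⟩

theorem Tm.pair {f : Γ → S} {g : Γ → T} (hf : Tm K M f) (hg : Tm K M g) :
    Tm K M (fun γ => (f γ, g γ)) := by
  obtain ⟨e, he⟩ := hf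
  obtain ⟨e', he'⟩ := hg
  exact ⟨Sum.elim e e', fun v p hv => ⟨he _ _ hv, he' _ _ hv⟩⟩

theorem Dfn.of_definable {P : S → Prop} {A : Set (Coded.ι K M S → M)}
    (hA : (∅ : Set M).Definable K A) (h : ∀ v, (∃ s, Coded.code (K := K) v s ∧ P s) ↔ v ∈ A) :
    Dfn K M P := by
  have e : {v : Coded.ι K M S → M | ∃ s, Coded.code (K := K) v s ∧ P s} = A := Set.ext h
  exact (congrArg _ e).mpr hA

/-- A tuple codes something exactly when it codes the same element as itself, so the set of codes is
the diagonal part of the coded equality. -/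
theorem dfn_true : Dfn K M (fun _ : S => True) := by
  refine Dfn.of_definable ((Coded.eq_definable (K := K) (M := M) (S := S)).preimage_comp
    (Sum.elim _root_.id _root_.id)) fun v => ?_
  exact ⟨fun ⟨s, h, _⟩ => ⟨s, h, h⟩, fun ⟨s, h, _⟩ => ⟨s, h, trivial⟩⟩

/-- The intersection with the codes of `Γ` is needed because a tuple that codes nothing in `Γ` may
still select to a code in `S`. -/
theorem Dfn.comp {P : S → Prop} (hP : Dfn K M P) {f : Γ → S} (hf : Tm K M f) :
    Dfn K M (fun γ => P (f γ)) := by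
  obtain ⟨e, he⟩ := hf
  refine Dfn.of_definable ((dfn_true (K := K) (M := M) (S := Γ)).inter
    (hP.preimage_comp e)) fun v => ?_
  constructor
  · rintro ⟨γ, h, h'⟩
    exact ⟨⟨γ, h, trivial⟩, f γ, he _ _ h, h'⟩
  · rintro ⟨⟨γ, h, -⟩, s, h', h''⟩
    exact ⟨γ, h, Coded.functional h' (he _ _ h) ▸ h''⟩

theorem Dfn.comp₂ {P : S → T → Prop} (hP : Dfn K M (fun p : S × T => P p.1 p.2)) {f : Γ → S}
    {g : Γ → T} (hf : Tm K M f) (hg : Tm K M g) : Dfn K M (fun γ => P (f γ) (g γ)) :=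
  hP.comp (hf.pair hg)

theorem Dfn.comp₃ {P : S → T → Δ → Prop}
    (hP : Dfn K M (fun p : S × T × Δ => P p.1 p.2.1 p.2.2)) {f : Γ → S}
    {g : Γ → T} {h : Γ → Δ} (hf : Tm K M f) (hg : Tm K M g) (hh : Tm K M h) :
    Dfn K M (fun γ => P (f γ) (g γ) (h γ)) :=
  hP.comp (hf.pair (hg.pair hh))

theorem Dfn.eq {f g : Γ → S} (hf : Tm K M f) (hg : Tm K M g) :
    Dfn K M (fun γ => f γ = g γ) := by
  refine Dfn.comp₂ (P := fun s t => s = t) ?_ hf hg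
  refine Dfn.of_definable (Coded.eq_definable (K := K) (M := M) (S := S)) fun v => ?_
  constructor
  · rintro ⟨⟨s, t⟩, ⟨h1, h2⟩, h⟩
    obtain rfl : s = t := h
    exact ⟨s, h1, h2⟩
  · rintro ⟨s, h1, h2⟩
    exact ⟨(s, s), ⟨h1, h2⟩, rfl⟩

theorem Dfn.and {P Q : Γ → Prop} (hP : Dfn K M P) (hQ : Dfn K M Q) :
    Dfn K M (fun γ => P γ ∧ Q γ) := by
  refine Dfn.of_definable (Set.Definable.inter hP hQ) fun v => ?_
  constructor
  · rintro ⟨γ, h, h1, h2⟩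
    exact ⟨⟨γ, h, h1⟩, γ, h, h2⟩
  · rintro ⟨⟨γ, h, h1⟩, γ', h', h2⟩
    exact ⟨γ, h, h1, Coded.functional h' h ▸ h2⟩

theorem Dfn.not {P : Γ → Prop} (hP : Dfn K M P) : Dfn K M (fun γ => ¬ P γ) := by
  refine Dfn.of_definable ((dfn_true (K := K) (M := M) (S := Γ)).inter
    (Set.Definable.compl hP)) fun v => ?_
  constructor
  · rintro ⟨γ, h, h1⟩
    exact ⟨⟨γ, h, trivial⟩, fun ⟨γ', h', h2⟩ => h1 (Coded.functional h' h ▸ h2)⟩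
  · rintro ⟨⟨γ, h, -⟩, h2⟩
    exact ⟨γ, h, fun h1 => h2 ⟨γ, h, h1⟩⟩

theorem Dfn.or {P Q : Γ → Prop} (hP : Dfn K M P) (hQ : Dfn K M Q) :
    Dfn K M (fun γ => P γ ∨ Q γ) := by
  simpa only [not_and_or, not_not] using (hP.not.and hQ.not).not

theorem Dfn.imp {P Q : Γ → Prop} (hP : Dfn K M P) (hQ : Dfn K M Q) :
    Dfn K M (fun γ => P γ → Q γ) := by
  simpa only [imp_iff_not_or] using hP.not.or hQ

theorem Dfn.iff {P Q : Γ → Prop} (hP : Dfn K M P) (hQ : Dfn K M Q) :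
    Dfn K M (fun γ => P γ ↔ Q γ) := by
  simpa only [iff_def] using (hP.imp hQ).and (hQ.imp hP)

/-- Quantification over a sort is a projection of sets of codes; nothing is lost because every
element of the sort has a code. -/
theorem Dfn.ex {P : Γ → S → Prop} (hP : Dfn K M (fun p : Γ × S => P p.1 p.2)) :
    Dfn K M (fun γ => ∃ s, P γ s) := by
  refine Dfn.of_definable (Set.Definable.image_comp hP Sum.inl) fun v => ?_
  constructor
  · rintro ⟨γ, h, s, hs⟩
    obtain ⟨w, hw⟩ := Coded.surj (K := K) (M := M) s
    exact ⟨Sum.elim v w, ⟨(γ, s), ⟨h, hw⟩, hs⟩, rfl⟩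
  · rintro ⟨w, ⟨⟨γ, s⟩, ⟨h, -⟩, hs⟩, rfl⟩
    exact ⟨γ, h, s, hs⟩

theorem Dfn.all {P : Γ → S → Prop} (hP : Dfn K M (fun p : Γ × S => P p.1 p.2)) :
    Dfn K M (fun γ => ∀ s, P γ s) := by
  simpa only [not_exists, not_not] using (Dfn.ex (P := fun γ s => ¬ P γ s) hP.not).not

end Definability

/-! ## Internal structures as interpreted sorts -/

section Internal

variable {L L' : FirstOrder.Language.{0, 0}} {M : Type u} [L'.Structure M] {X : Classes M}

theorem definable_of_mem {n : ℕ} {S : Set (Fin n → M)} (hS : S ∈ X n) :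
    (∅ : Set M).Definable (L'.sum (classLang X)) S := by
  refine Set.empty_definable_iff.2 ⟨Relations.formula (L := L'.sum (classLang X))
    (Sum.inr ⟨S, hS⟩) (fun i => Term.var i), ?_⟩
  ext v
  exact (Formula.realize_rel (L := L'.sum (classLang X)) (M := M) (R := Sum.inr ⟨S, hS⟩)
    (ts := fun i => Term.var i) (v := v)).symm

theorem IsSPCModel.mem_of_definable {T : Set (Scheme L')} (hX : IsSPCModel T M X) {n : ℕ}
    {S : Set (Fin n → M)} (hS : (∅ : Set M).Definable (L'.sum (classLang X)) S) : S ∈ X n := by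
  obtain ⟨φ, rfl⟩ := Set.empty_definable_iff.1 hS
  exact hX.comprehension n φ

namespace InternalStructure

variable (N : InternalStructure L X)

instance coded : Coded (L'.sum (classLang X)) M N.Carrier where
  ι := Unit
  finite := inferInstance
  code v c := ∃ h : v () ∈ N.dom, Quotient.mk N.setoid ⟨v (), h⟩ = c
  functional := by rintro v s t ⟨h, rfl⟩ ⟨_, rfl⟩; rfl
  surj c := by
    obtain ⟨m, rfl⟩ := Quotient.exists_rep c
    exact ⟨fun _ => m, m.2, rfl⟩
  eq_definable := by
    convert (((definable_of_mem (L' := L') N.dom_mem).preimage_comp (fun _ => Sum.inl ())).inter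
      ((definable_of_mem (L' := L') N.dom_mem).preimage_comp (fun _ => Sum.inr ()))).inter
      ((definable_of_mem (L' := L') N.eqv_mem).preimage_comp
        ![Sum.inl (), Sum.inr ()]) using 1
    ext v
    constructor
    · rintro ⟨s, ⟨h, rfl⟩, h', h2⟩
      exact ⟨⟨h, h'⟩, Quotient.exact h2.symm⟩
    · rintro ⟨⟨h, h'⟩, h2⟩
      exact ⟨_, ⟨h, rfl⟩, h', (Quotient.sound h2).symm⟩

/-- The element of the universe of `N` represented by an element of its domain. -/
def toCarrier (a : N.dom) : N.Carrier := Quotient.mk N.setoid a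

/-- The congruence property makes the choice of representatives irrelevant. -/
theorem induced_rel_iff {n : ℕ} (R : L.Relations n) (w : Fin n → N.dom) :
    (fun i => Quotient.mk N.setoid (w i)) ∈ N.induced (N.rel R) ↔ (fun i => (w i : M)) ∈ N.rel R := by
  constructor
  · rintro ⟨w', h, h'⟩
    exact N.congr R _ _ (fun i => (w' i).2) (fun i => (w i).2) (fun i => Quotient.exact (h i)) h'
  · intro h
    exact ⟨w, fun _ => rfl, h⟩

theorem dfn_rel₁ [L.IsRelational] (R : L.Relations 1) :
    Dfn (L'.sum (classLang X)) M
      (fun c : N.Carrier => Structure.RelMap R ![c]) := by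
  refine Dfn.of_definable ((dfn_true (K := L'.sum (classLang X)) (M := M) (S := N.Carrier)).inter
    ((definable_of_mem (L' := L') (N.rel_mem R)).preimage_comp (fun _ => ()))) fun v => ?_
  have key : ∀ h : v () ∈ N.dom, (Structure.RelMap R ![(N.toCarrier ⟨v (), h⟩ : N.Carrier)] ↔
      v ∘ (fun _ => ()) ∈ N.rel R) := by
    intro h
    refine Iff.trans ?_ (N.induced_rel_iff R (fun _ => ⟨v (), h⟩))
    refine iff_of_eq (congrArg (· ∈ N.induced (N.rel R)) ?_)
    ext i
    fin_cases i
    rfl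
  constructor
  · rintro ⟨s, ⟨h, rfl⟩, h2⟩
    exact ⟨⟨_, ⟨h, rfl⟩, trivial⟩, (key h).1 h2⟩
  · rintro ⟨⟨_, ⟨h, rfl⟩, -⟩, h2⟩
    exact ⟨_, ⟨h, rfl⟩, (key h).2 h2⟩

theorem dfn_rel₂ [L.IsRelational] (R : L.Relations 2) :
    Dfn (L'.sum (classLang X)) M
      (fun p : N.Carrier × N.Carrier => Structure.RelMap R ![p.1, p.2]) := by
  refine Dfn.of_definable ((dfn_true (K := L'.sum (classLang X)) (M := M) (S := N.Carrier × N.Carrier)).inter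
    ((definable_of_mem (L' := L') (N.rel_mem R)).preimage_comp
      ![Sum.inl (), Sum.inr ()])) fun v => ?_
  have key : ∀ (h : v (Sum.inl ()) ∈ N.dom) (h' : v (Sum.inr ()) ∈ N.dom),
      (Structure.RelMap R ![(N.toCarrier ⟨v (Sum.inl ()), h⟩ : N.Carrier),
        N.toCarrier ⟨v (Sum.inr ()), h'⟩] ↔
      v ∘ ![Sum.inl (), Sum.inr ()] ∈ N.rel R) := by
    intro h h'
    have e : (fun i => ((![⟨v (Sum.inl ()), h⟩, ⟨v (Sum.inr ()), h'⟩] : Fin 2 → N.dom) i : M)) =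
        v ∘ ![Sum.inl (), Sum.inr ()] := by
      ext i
      fin_cases i <;> rfl
    rw [← e]
    refine Iff.trans ?_ (N.induced_rel_iff R ![⟨v (Sum.inl ()), h⟩, ⟨v (Sum.inr ()), h'⟩])
    refine iff_of_eq (congrArg (· ∈ N.induced (N.rel R)) ?_)
    ext i
    fin_cases i <;> rfl
  constructor
  · rintro ⟨⟨s, t⟩, ⟨⟨h, rfl⟩, h', e⟩, h2⟩
    obtain rfl : _ = t := e
    exact ⟨⟨(_, _), ⟨⟨h, rfl⟩, h', rfl⟩, trivial⟩, (key h h').1 h2⟩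
  · rintro ⟨⟨⟨_, _⟩, ⟨⟨h, -⟩, h', -⟩, -⟩, h2⟩
    exact ⟨(N.toCarrier ⟨_, h⟩, N.toCarrier ⟨_, h'⟩), ⟨⟨h, rfl⟩, h', rfl⟩, (key h h').2 h2⟩

/-- In a strong model of a scheme with a ternary predicate, that predicate can be any definable
one. -/
theorem exists_class₃ {T : Set (Scheme L')} (hX : IsSPCModel T M X)
    {P : N.Carrier → N.Carrier → N.Carrier → Prop}
    (hP : Dfn (L'.sum (classLang X)) M
      (fun p : N.Carrier × N.Carrier × N.Carrier => P p.1 p.2.1 p.2.2)) :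
    ∃ S ∈ X 3, N.Invariant S ∧ N.induced S = {v | P (v 0) (v 1) (v 2)} := by
  -- The class is the set of all triples of representatives of triples satisfying `P`. It is
  -- invariant since equivalent representatives denote the same element of the quotient.
  refine ⟨_, hX.mem_of_definable (Set.Definable.preimage_comp
    (Sum.elim (fun _ => 0) (Sum.elim (fun _ => 1) fun _ => 2) : Unit ⊕ Unit ⊕ Unit → Fin 3) hP),
    ?_, ?_⟩
  · rintro v w hv hw h ⟨⟨a, b, c⟩, ⟨⟨h0, rfl⟩, ⟨h1, rfl⟩, h2, rfl⟩, hp⟩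
    refine ⟨⟨_, _, _⟩, ⟨⟨hw 0, rfl⟩, ⟨hw 1, rfl⟩, hw 2, rfl⟩, ?_⟩
    have e : ∀ i, (Quotient.mk N.setoid ⟨v i, hv i⟩ : N.Carrier) =
      Quotient.mk N.setoid ⟨w i, hw i⟩ := fun i => Quotient.sound (h i)
    have := e 0 ▸ e 1 ▸ e 2 ▸ hp
    exact this
  · ext v
    constructor
    · rintro ⟨w, hw, ⟨a, b, c⟩, ⟨⟨_, rfl⟩, ⟨_, rfl⟩, _, rfl⟩, hp⟩
      change P _ _ _
      rw [← hw 0, ← hw 1, ← hw 2]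
      exact hp
    · intro hp
      choose w hw using fun i => Quotient.exists_rep (v i)
      refine ⟨w, hw, ⟨v 0, v 1, v 2⟩, ⟨⟨(w 0).2, hw 0⟩, ⟨(w 1).2, hw 1⟩, (w 2).2, hw 2⟩, hp⟩

end InternalStructure

end Internal

/-! ## Meaning of the formulas of set theory -/

section Semantics

variable {C : Type u} (E : C → C → Prop) (A : C → Prop)

/-- `p = {x, y}` -/
def IsPair (p x y : C) : Prop := ¬ A p ∧ ∀ w, E w p ↔ w = x ∨ w = y

/-- `p = ⟨x, y⟩` -/
def IsOrdPair (p x y : C) : Prop := ¬ A p ∧ ∀ w, E w p ↔ IsPair E A w x x ∨ IsPair E A w x y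

/-- `⟨x, y⟩ ∈ f` -/
def OrdPairMem (f x y : C) : Prop := ∃ p, E p f ∧ IsOrdPair E A p x y

/-- `x` is a set that is empty or a successor. -/
def ZeroOrSucc (x : C) : Prop :=
  ¬ A x ∧ ((∀ y, ¬ E y x) ∨ ∃ k, ∀ y, E y x ↔ E y k ∨ y = k)

/-- `x` is transitive. -/
def IsTrans (x : C) : Prop := ∀ y z, E y x → E z y → E z x

/-- `x` is a natural number. -/
def IsNat (x : C) : Prop :=
  (IsTrans E x ∧ ZeroOrSucc E A x) ∧ ∀ y, E y x → IsTrans E y ∧ ZeroOrSucc E A y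

/-- `f` is a bijection from `m` to `a`. -/
def IsBij (f m a : C) : Prop :=
  ((¬ A f ∧ ∀ p, E p f → ∃ x y, (E x m ∧ E y a) ∧ IsOrdPair E A p x y) ∧
    ∀ x, E x m → ∃ y, OrdPairMem E A f x y ∧ ∀ z, OrdPairMem E A f x z → z = y) ∧
    ∀ y, E y a → ∃ x, OrdPairMem E A f x y ∧ ∀ z, OrdPairMem E A f z y → z = x

variable {K : FirstOrder.Language.{0, 0}} [K.Structure C] (e : K.Relations 2) (a : K.Relations 1)
  {n : ℕ} {u : Empty → C} (v : Fin n → C)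

@[simp] theorem realize_eqF (i j : Fin n) :
    (eqF (K := K) i j).Realize u v ↔ v i = v j := by
  simp [eqF]

@[simp] theorem realize_relF (i j : Fin n) :
    (relF e i j).Realize u v ↔ Structure.RelMap e ![v i, v j] := by
  rw [relF, BoundedFormula.realize_rel]
  refine iff_of_eq (congrArg _ ?_)
  ext k
  fin_cases k <;> rfl

@[simp] theorem realize_atomF (i : Fin n) :
    (atomF a i).Realize u v ↔ Structure.RelMap a ![v i] := by
  rw [atomF, BoundedFormula.realize_rel]
  refine iff_of_eq (congrArg _ ?_)
  ext k
  fin_cases k; rfl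

local notation "EE" => fun x y => Structure.RelMap e ![x, y]
local notation "AA" => fun x => Structure.RelMap a ![x]

@[simp] theorem realize_isPairF (p i j : Fin n) :
    (isPairF e a p i j).Realize u v ↔ IsPair EE AA (v p) (v i) (v j) := by
  simp [isPairF, IsPair]

@[simp] theorem realize_isOrdPairF (p i j : Fin n) :
    (isOrdPairF e a p i j).Realize u v ↔ IsOrdPair EE AA (v p) (v i) (v j) := by
  simp [isOrdPairF, IsOrdPair]

@[simp] theorem realize_ordPairMemF (p i j : Fin n) :
    (ordPairMemF e a p i j).Realize u v ↔ OrdPairMem EE AA (v p) (v i) (v j) := by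
  simp [ordPairMemF, OrdPairMem]

@[simp] theorem realize_zeroOrSuccF (i : Fin n) :
    (zeroOrSuccF e a i).Realize u v ↔ ZeroOrSucc EE AA (v i) := by
  simp [zeroOrSuccF, ZeroOrSucc]

@[simp] theorem realize_transF (i : Fin n) :
    (transF e i).Realize u v ↔ IsTrans EE (v i) := by
  simp [transF, IsTrans]

@[simp] theorem realize_isNatF (i : Fin n) :
    (isNatF e a i).Realize u v ↔ IsNat EE AA (v i) := by
  simp [isNatF, IsNat]

@[simp] theorem realize_isBijF (f m i : Fin n) :
    (isBijF e a f m i).Realize u v ↔ IsBij EE AA (v f) (v m) (v i) := by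
  simp [isBijF, IsBij]

end Semantics

/-! ### Reading off the axioms and schemes of `HF(DLO)` -/

section HFSemantics

variable {C : Type u} [(ordLang.sum hfLang).Structure C]

theorem realize_powersetAx : C ⊨ (powersetAx : (ordLang.sum hfLang).Sentence) ↔
    ∀ x : C, ∃ y, ∀ z, Structure.RelMap (memS (L := ordLang)) ![z, y] ↔
      ¬ Structure.RelMap (atomS (L := ordLang)) ![z] ∧
      ∀ w, Structure.RelMap (memS (L := ordLang)) ![w, z] →
        Structure.RelMap (memS (L := ordLang)) ![w, x] := by
  simp [powersetAx, Sentence.Realize, Formula.Realize, Fin.snoc]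

theorem realize_unionAx : C ⊨ (unionAx : (ordLang.sum hfLang).Sentence) ↔
    ∀ x : C, ∃ y, ¬ Structure.RelMap (atomS (L := ordLang)) ![y] ∧
      ∀ z, Structure.RelMap (memS (L := ordLang)) ![z, y] ↔
        ∃ w, Structure.RelMap (memS (L := ordLang)) ![w, x] ∧
          Structure.RelMap (memS (L := ordLang)) ![z, w] := by
  simp [unionAx, Sentence.Realize, Formula.Realize, Fin.snoc]

theorem realize_finiteAx : C ⊨ (finiteAx : (ordLang.sum hfLang).Sentence) ↔
    ∀ x : C, ¬ Structure.RelMap (atomS (L := ordLang)) ![x] → ∃ n f,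
      IsNat (fun x y : C => Structure.RelMap (memS (L := ordLang)) ![x, y])
        (fun x => Structure.RelMap (atomS (L := ordLang)) ![x]) n ∧
      IsBij (fun x y : C => Structure.RelMap (memS (L := ordLang)) ![x, y])
        (fun x => Structure.RelMap (atomS (L := ordLang)) ![x]) f n x := by
  simp [finiteAx, Sentence.Realize, Formula.Realize, Fin.snoc]

theorem realize_extAx : C ⊨ (extAx : (ordLang.sum hfLang).Sentence) ↔
    ∀ x y : C, ¬ Structure.RelMap (atomS (L := ordLang)) ![x] →
      ¬ Structure.RelMap (atomS (L := ordLang)) ![y] →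
      (∀ z, Structure.RelMap (memS (L := ordLang)) ![z, x] ↔
        Structure.RelMap (memS (L := ordLang)) ![z, y]) → x = y := by
  simp [extAx, Sentence.Realize, Formula.Realize, Fin.snoc]

theorem realize_atomAx : C ⊨ (atomAx : (ordLang.sum hfLang).Sentence) ↔
    ∀ x : C, Structure.RelMap (atomS (L := ordLang)) ![x] →
      ∀ y, ¬ Structure.RelMap (memS (L := ordLang)) ![y, x] := by
  simp [atomAx, Sentence.Realize, Formula.Realize, Fin.snoc]

/-- The order symbol in `{<, ∈, A}`. -/
def ltS : (ordLang.sum hfLang).Relations 2 := Sum.inl ordLt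

theorem realize_confinedAx (h : C ⊨ (confinedAx : (ordLang.sum hfLang).Sentence)) (x y : C)
    (hxy : Structure.RelMap ltS ![x, y]) : Structure.RelMap (atomS (L := ordLang)) ![x] ∧
      Structure.RelMap (atomS (L := ordLang)) ![y] := by
  unfold confinedAx at h
  rw [Sentence.Realize, Formula.Realize, BoundedFormula.realize_iInf] at h
  have h1 := h ⟨2, ordLt⟩
  have h2 := (BoundedFormula.realize_alls.1 h1) ![x, y]
  rw [BoundedFormula.realize_imp, BoundedFormula.realize_rel, BoundedFormula.realize_iInf] at h2
  have h3 := h2 hxy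
  have h4 := h3 0
  have h5 := h3 1
  rw [realize_atomF] at h4 h5
  exact ⟨h4, h5⟩

section Relativize

variable {L K : FirstOrder.Language.{0, 0}} (ι : L →ᴸ K) (a : K.Relations 1) {n : ℕ}

@[simp] theorem relativize_not (φ : L.BoundedFormula Empty n) :
    relativize ι a (∼φ) = ∼(relativize ι a φ) := rfl

@[simp] theorem relativize_imp (φ ψ : L.BoundedFormula Empty n) :
    relativize ι a (φ.imp ψ) = (relativize ι a φ).imp (relativize ι a ψ) := rfl

@[simp] theorem relativize_inf (φ ψ : L.BoundedFormula Empty n) :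
    relativize ι a (φ ⊓ ψ) = relativize ι a φ ⊓ relativize ι a ψ := rfl

@[simp] theorem relativize_sup (φ ψ : L.BoundedFormula Empty n) :
    relativize ι a (φ ⊔ ψ) = relativize ι a φ ⊔ relativize ι a ψ := rfl

@[simp] theorem relativize_all (φ : L.BoundedFormula Empty (n + 1)) :
    relativize ι a (∀' φ) = ∀' ((atomF a (Fin.last n)).imp (relativize ι a φ)) := rfl

@[simp] theorem relativize_ex (φ : L.BoundedFormula Empty (n + 1)) :
    relativize ι a (∃' φ) = ∼(∀' ((atomF a (Fin.last n)).imp (∼(relativize ι a φ)))) := rfl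

@[simp] theorem relativize_eqF (i j : Fin n) : relativize ι a (eqF i j) = eqF i j := rfl

end Relativize

@[simp] theorem relativize_ltF (a : (ordLang.sum hfLang).Relations 1) {n : ℕ} (i j : Fin n) :
    relativize LHom.sumInl a (ltF i j) = relF ltS i j := by
  refine congrArg (BoundedFormula.rel _) ?_
  ext k
  fin_cases k <;> rfl

theorem realize_relativizedAx_DLO
    (h : C ⊨ (relativizedAx DLO : (ordLang.sum hfLang).Sentence)) :
    let A := fun x : C => Structure.RelMap (atomS (L := ordLang)) ![x]
    let lt := fun x y : C => Structure.RelMap ltS ![x, y]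
    (∃ x, A x) ∧ (∀ x, A x → ¬ lt x x) ∧
      (∀ x, A x → ∀ y, A y → ∀ z, A z → lt x y → lt y z → lt x z) ∧
      (∀ x, A x → ∀ y, A y → lt x y ∨ x = y ∨ lt y x) ∧
      (∀ x, A x → ∀ y, A y → lt x y → ∃ z, A z ∧ lt x z ∧ lt z y) ∧
      (∀ x, A x → ∃ y, A y ∧ lt x y) ∧ (∀ x, A x → ∃ y, A y ∧ lt y x) := by
  unfold relativizedAx at h
  rw [Sentence.Realize, Formula.Realize, BoundedFormula.realize_iInf] at h
  have h1 := h ⟨_, Or.inl rfl⟩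
  have h2 := h ⟨_, Or.inr (Or.inl rfl)⟩
  have h3 := h ⟨_, Or.inr (Or.inr (Or.inl rfl))⟩
  have h4 := h ⟨_, Or.inr (Or.inr (Or.inr (Or.inl rfl)))⟩
  have h5 := h ⟨_, Or.inr (Or.inr (Or.inr (Or.inr (Or.inl rfl))))⟩
  have h6 := h ⟨_, Or.inr (Or.inr (Or.inr (Or.inr (Or.inr (Or.inl rfl)))))⟩
  have h7 := h ⟨_, Or.inr (Or.inr (Or.inr (Or.inr (Or.inr (Or.inr rfl)))))⟩
  simp [Fin.snoc] at h1 h2 h3 h4 h5 h6 h7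
  refine ⟨h1, h2, h3, fun x hx y hy => ?_, h5, h6, h7⟩
  simpa [or_assoc] using h4 x hx y hy

section Ternary

variable {K : FirstOrder.Language.{0, 0}} {C : Type u} [K.Structure C] [(predLang 3).Structure C]
  {n : ℕ} {u : Empty → C} (v : Fin n → C)

@[simp] theorem realize_predF (i j k : Fin n) :
    (predF (K := K) i j k).Realize u v ↔
      Structure.RelMap (predS 3) ![v i, v j, v k] := by
  rw [predF, BoundedFormula.realize_rel]
  refine iff_of_eq (congrArg (Structure.RelMap (predS 3)) ?_)
  ext k
  fin_cases k <;> rfl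

end Ternary

variable [(predLang 3).Structure C]

@[simp] theorem relMap_memP (x y : C) :
    Structure.RelMap (memP (L := ordLang)) ![x, y] ↔
      Structure.RelMap (memS (L := ordLang)) ![x, y] := Iff.rfl

theorem realize_replScheme : C ⊨ (replScheme (L := ordLang)) ↔
    ∀ p a : C, (∀ x, Structure.RelMap (memS (L := ordLang)) ![x, a] → ∀ y z,
      Structure.RelMap (predS 3) ![p, x, y] → Structure.RelMap (predS 3) ![p, x, z] → y = z) →
    ∃ b, ∀ y, Structure.RelMap (memS (L := ordLang)) ![y, b] ↔
      ∃ x, Structure.RelMap (memS (L := ordLang)) ![x, a] ∧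
        Structure.RelMap (predS 3) ![p, x, y] := by
  simp [replScheme, Sentence.Realize, Formula.Realize, Fin.snoc]

theorem realize_inductionScheme : C ⊨ (inductionScheme (L := ordLang)) ↔
    ∀ p q : C, (∀ x, (∀ y, Structure.RelMap (memS (L := ordLang)) ![y, x] →
        Structure.RelMap (predS 3) ![p, q, y]) → Structure.RelMap (predS 3) ![p, q, x]) →
      ∀ x, Structure.RelMap (predS 3) ![p, q, x] := by
  simp [inductionScheme, Sentence.Realize, Formula.Realize, Fin.snoc]

end HFSemantics

/-! ## Strong models of `HF(DLO)` -/

/-- The sort `C` with the relations `E`, `A`, `lt` is a model of `HF(DLO)`, where the schemes are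
required of all definable predicates. -/
structure IsHF (K : FirstOrder.Language.{0, u}) (M : Type u) [K.Structure M] {C : Type u}
    [Coded K M C] (E : C → C → Prop) (A : C → Prop) (lt : C → C → Prop) : Prop where
  dfn_mem : Dfn K M (fun p : C × C => E p.1 p.2)
  dfn_atom : Dfn K M A
  dfn_lt : Dfn K M (fun p : C × C => lt p.1 p.2)
  repl : ∀ P : C → C → C → Prop, Dfn K M (fun p : C × C × C => P p.1 p.2.1 p.2.2) → ∀ p a,
    (∀ x, E x a → ∀ y z, P p x y → P p x z → y = z) → ∃ b, ∀ y, E y b ↔ ∃ x, E x a ∧ P p x y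
  ind : ∀ P : C → Prop, Dfn K M P → (∀ x, (∀ y, E y x → P y) → P x) → ∀ x, P x
  powerset : ∀ x, ∃ y, ∀ z, E z y ↔ ¬ A z ∧ ∀ w, E w z → E w x
  union : ∀ x, ∃ y, ¬ A y ∧ ∀ z, E z y ↔ ∃ w, E w x ∧ E z w
  finite : ∀ x, ¬ A x → ∃ n f, IsNat E A n ∧ IsBij E A f n x
  ext : ∀ x y, ¬ A x → ¬ A y → (∀ z, E z x ↔ E z y) → x = y
  not_mem_atom : ∀ x, A x → ∀ y, ¬ E y x
  atom_of_lt : ∀ x y, lt x y → A x ∧ A y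
  exists_atom : ∃ x, A x
  lt_irrefl : ∀ x, A x → ¬ lt x x
  lt_trans : ∀ x, A x → ∀ y, A y → ∀ z, A z → lt x y → lt y z → lt x z
  lt_trichotomy : ∀ x, A x → ∀ y, A y → lt x y ∨ x = y ∨ lt y x
  dense : ∀ x, A x → ∀ y, A y → lt x y → ∃ z, A z ∧ lt x z ∧ lt z y
  exists_gt : ∀ x, A x → ∃ y, A y ∧ lt x y
  exists_lt : ∀ x, A x → ∃ y, A y ∧ lt y x

theorem InternalStructure.Strong.isHF {L' : FirstOrder.Language.{0, 0}} {M : Type u}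
    [L'.Structure M] {X : Classes M} {T : Set (Scheme L')} (hX : IsSPCModel T M X)
    (N : InternalStructure (ordLang.sum hfLang) X) (hN : N.Strong (hf DLO)) :
    IsHF (L'.sum (classLang X)) M
      (fun x y : N.Carrier => Structure.RelMap (memS (L := ordLang)) ![x, y])
      (fun x => Structure.RelMap (atomS (L := ordLang)) ![x])
      (fun x y => Structure.RelMap ltS ![x, y]) := by
  have key : ∀ P : N.Carrier → N.Carrier → N.Carrier → Prop,
      Dfn (L'.sum (classLang X)) M (fun p : N.Carrier × N.Carrier × N.Carrier =>
        P p.1 p.2.1 p.2.2) → ∃ _ : (predLang 3).Structure N.Carrier,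
      (∀ x y z, Structure.RelMap (predS 3) ![x, y, z] ↔ P x y z) ∧
      N.Carrier ⊨ (replScheme (L := ordLang)) ∧ N.Carrier ⊨ (inductionScheme (L := ordLang)) ∧
      N.Carrier ⊨ (powersetAx ⊓ unionAx ⊓ finiteAx ⊓ extAx ⊓ atomAx ⊓ confinedAx ⊓
        relativizedAx DLO : (ordLang.sum hfLang).Sentence) := by
    intro P hP
    obtain ⟨S, hS, hinv, hi⟩ := N.exists_class₃ hX hP
    have h := hN S hS hinv
    let st : (predLang 3).Structure N.Carrier := predStructure (N.induced S)
    refine ⟨st, fun x y z => ?_, ?_⟩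
    · change ![x, y, z] ∈ N.induced S ↔ _
      rw [hi]
      rfl
    · have h' : N.Carrier ⊨ (replScheme (L := ordLang) ⊓ inductionScheme (L := ordLang) ⊓
        LHom.sumInl.onSentence (powersetAx ⊓ unionAx ⊓ finiteAx ⊓ extAx ⊓ atomAx ⊓ confinedAx ⊓
          relativizedAx DLO)) := h
      rw [Sentence.Realize, Formula.Realize, BoundedFormula.realize_inf,
        BoundedFormula.realize_inf] at h'
      exact ⟨h'.1.1, h'.1.2, (LHom.realize_onSentence (L' := (ordLang.sum hfLang).sum (predLang 3)) N.Carrier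
        LHom.sumInl _).1 h'.2⟩
  -- The axioms without `P` can be read off from any single instance of the scheme; the trivial
  -- predicate serves.
  obtain ⟨_, -, -, -, h⟩ := key (fun _ _ _ => True) dfn_true
  simp only [Sentence.Realize, Formula.Realize, BoundedFormula.realize_inf] at h
  obtain ⟨⟨⟨⟨⟨⟨h1, h2⟩, h3⟩, h4⟩, h5⟩, h6⟩, h7⟩ := h
  obtain ⟨g1, g2, g3, g4, g5, g6, g7⟩ := realize_relativizedAx_DLO h7
  exact
  { dfn_mem := N.dfn_rel₂ _
    dfn_atom := N.dfn_rel₁ _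
    dfn_lt := N.dfn_rel₂ _
    repl := fun P hP => by
      obtain ⟨_, hs, h, -⟩ := key P hP
      simpa only [hs] using realize_replScheme.1 h
    ind := fun P hP => by
      -- Unary induction suffices below, so the two parameters of the scheme become dummies, filled
      -- with an arbitrary atom.
      obtain ⟨_, hs, -, h, -⟩ := key (fun _ _ x => P x) (hP.comp Tm.id.snd.snd)
      obtain ⟨c, -⟩ := g1
      simpa only [hs] using realize_inductionScheme.1 h c c
    powerset := realize_powersetAx.1 h1
    union := realize_unionAx.1 h2
    finite := realize_finiteAx.1 h3
    ext := realize_extAx.1 h4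
    not_mem_atom := realize_atomAx.1 h5
    atom_of_lt := realize_confinedAx h6
    exists_atom := g1
    lt_irrefl := g2
    lt_trans := g3
    lt_trichotomy := g4
    dense := g5
    exists_gt := g6
    exists_lt := g7 }

/-! ## Set theory in models of `HF(DLO)` -/

theorem IsPair.inj {C : Type u} {E : C → C → Prop} {A : C → Prop} {p x y x' y' : C} (h1 : IsPair E A p x y) (h2 : IsPair E A p x' y') :
    (x = x' ∧ y = y') ∨ (x = y' ∧ y = x') := by
  have a1 := (h2.2 x).1 ((h1.2 x).2 (Or.inl rfl))
  have a2 := (h2.2 y).1 ((h1.2 y).2 (Or.inr rfl))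
  have a3 := (h1.2 x').1 ((h2.2 x').2 (Or.inl rfl))
  have a4 := (h1.2 y').1 ((h2.2 y').2 (Or.inr rfl))
  grind

namespace IsHF

variable {K : FirstOrder.Language.{0, u}} {M : Type u} [K.Structure M] {C Γ : Type u}
  [Coded K M C] [Coded K M Γ] {E : C → C → Prop} {A : C → Prop} {lt : C → C → Prop}
  (h : IsHF K M E A lt)

include h

theorem mem {f g : Γ → C} (hf : Tm K M f) (hg : Tm K M g) : Dfn K M (fun γ => E (f γ) (g γ)) :=
  h.dfn_mem.comp (hf.pair hg)

theorem atom {f : Γ → C} (hf : Tm K M f) : Dfn K M (fun γ => A (f γ)) :=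
  h.dfn_atom.comp hf

theorem lt_dfn {f g : Γ → C} (hf : Tm K M f) (hg : Tm K M g) :
    Dfn K M (fun γ => lt (f γ) (g γ)) :=
  h.dfn_lt.comp (hf.pair hg)

/-- The union of an atom is a set without elements. -/
theorem exists_empty : ∃ e, ¬ A e ∧ ∀ z, ¬ E z e := by
  obtain ⟨a, ha⟩ := h.exists_atom
  obtain ⟨e, he, he'⟩ := h.union a
  exact ⟨e, he, fun z hz => by
    obtain ⟨w, hw, -⟩ := (he' z).1 hz
    exact h.not_mem_atom a ha w hw⟩

theorem not_atom_of_mem {x y : C} (hxy : E x y) : ¬ A y := fun hy => h.not_mem_atom y hy x hxy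

/-- The power set of the empty set has an element; replacement by the constant map with value `x`
turns it into a singleton. -/
theorem exists_singleton (x : C) : ∃ s, ¬ A s ∧ ∀ z, E z s ↔ z = x := by
  obtain ⟨e, he, he'⟩ := h.exists_empty
  obtain ⟨q, hq⟩ := h.powerset e
  obtain ⟨b, hb⟩ := h.repl (fun p _ y => y = p) (Dfn.eq Tm.id.snd.snd Tm.id.fst) x q
    (fun _ _ y z hy hz => hy.trans hz.symm)
  have hb' : ∀ z, E z b ↔ z = x := fun z =>
    ⟨fun hz => ((hb z).1 hz).elim fun _ hw => hw.2, fun hz =>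
      (hb z).2 ⟨e, (hq e).2 ⟨he, fun w hw => hw⟩, hz⟩⟩
  exact ⟨b, h.not_atom_of_mem ((hb' x).2 rfl), hb'⟩

/-- The power set of `{x}` consists of `∅` and `{x}`. Replacement with parameter `y` sends `∅` to
`y` and `{x}` to its only element. -/
theorem exists_pair (x y : C) : ∃ s, IsPair E A s x y := by
  obtain ⟨e, he, he'⟩ := h.exists_empty
  obtain ⟨s, hs, hs'⟩ := h.exists_singleton x
  obtain ⟨q, hq⟩ := h.powerset s
  have dfn : Dfn K M (fun p : C × C × C => ((∀ z, ¬ E z p.2.1) ∧ p.2.2 = p.1) ∨ E p.2.2 p.2.1) :=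
    ((Dfn.all (h.mem Tm.id.snd Tm.id.fst.snd.fst).not).and
      (Dfn.eq Tm.id.snd.snd Tm.id.fst)).or (h.mem Tm.id.snd.snd Tm.id.snd.fst)
  obtain ⟨b, hb⟩ := h.repl (fun p u v => ((∀ z, ¬ E z u) ∧ v = p) ∨ E v u) dfn y q (by
    rintro u hu v w (⟨h1, rfl⟩ | h1) (⟨h2, rfl⟩ | h2)
    · rfl
    · exact absurd h2 (h1 _)
    · exact absurd h1 (h2 _)
    · have := ((hq u).1 hu).2
      rw [(hs' v).1 (this v h1), (hs' w).1 (this w h2)])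
  have hb' : ∀ w, E w b ↔ w = x ∨ w = y := by
    intro w
    rw [hb]
    constructor
    · rintro ⟨u, hu, ⟨-, rfl⟩ | h1⟩
      · exact Or.inr rfl
      · exact Or.inl ((hs' w).1 (((hq u).1 hu).2 w h1))
    · rintro (rfl | rfl)
      · exact ⟨s, (hq s).2 ⟨hs, fun _ h => h⟩, Or.inr ((hs' _).2 rfl)⟩
      · exact ⟨e, (hq e).2 ⟨he, fun z hz => absurd hz (he' z)⟩, Or.inl ⟨he', rfl⟩⟩
  exact ⟨b, h.not_atom_of_mem ((hb' x).2 (Or.inl rfl)), hb'⟩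

/-- This is the union of `{a, {x}}`. It also works for an atom `a`, which then counts as empty. -/
theorem exists_insert (a x : C) : ∃ c, ¬ A c ∧ ∀ z, E z c ↔ E z a ∨ z = x := by
  obtain ⟨s, hs, hs'⟩ := h.exists_singleton x
  obtain ⟨p, -, hp⟩ := h.exists_pair a s
  obtain ⟨c, hc, hc'⟩ := h.union p
  refine ⟨c, hc, fun z => ?_⟩
  rw [hc']
  constructor
  · rintro ⟨w, hw, hz⟩
    rcases (hp w).1 hw with rfl | rfl
    · exact Or.inl hz
    · exact Or.inr ((hs' z).1 hz)
  · rintro (hz | rfl)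
    · exact ⟨a, (hp a).2 (Or.inl rfl), hz⟩
    · exact ⟨s, (hp s).2 (Or.inr rfl), (hs' z).2 rfl⟩

theorem exists_erase (a x : C) : ∃ c, ¬ A c ∧ ∀ z, E z c ↔ E z a ∧ z ≠ x := by
  obtain ⟨b, hb⟩ := h.repl (fun p u y => y = u ∧ u ≠ p)
    ((Dfn.eq Tm.id.snd.snd Tm.id.snd.fst).and (Dfn.eq Tm.id.snd.fst Tm.id.fst).not) x a
    (fun _ _ y z hy hz => hy.1.trans hz.1.symm)
  -- Replacement does not guarantee that `b` is a non-atom when it has no elements; the union of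
  -- `{b}` has the same elements and is a set.
  obtain ⟨s, hs, hs'⟩ := h.exists_singleton b
  obtain ⟨c, hc, hc'⟩ := h.union s
  refine ⟨c, hc, fun z => ?_⟩
  rw [hc']
  constructor
  · rintro ⟨w, hw, hz⟩
    obtain rfl := (hs' w).1 hw
    obtain ⟨u, hu, rfl, hx⟩ := (hb z).1 hz
    exact ⟨hu, hx⟩
  · rintro ⟨hz, hx⟩
    exact ⟨b, (hs' b).2 rfl, (hb z).2 ⟨z, hz, rfl, hx⟩⟩

theorem mem_irrefl (x : C) : ¬ E x x :=
  h.ind (fun x => ¬ E x x) (h.mem Tm.id Tm.id).not (fun x hx hxx => hx x hxx hxx) x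

theorem isOrdPair_inj {p x y x' y' : C} (h1 : IsOrdPair E A p x y)
    (h2 : IsOrdPair E A p x' y') : x = x' ∧ y = y' := by
  -- The elements of `p` are given only by description, so the unordered pairs must first be shown
  -- to exist before the two descriptions can be compared.
  obtain ⟨s, hs⟩ := h.exists_pair x x
  obtain ⟨t, ht⟩ := h.exists_pair x y
  obtain ⟨s', hs'⟩ := h.exists_pair x' x'
  obtain ⟨t', ht'⟩ := h.exists_pair x' y'
  have b1 := (h2.2 s).1 ((h1.2 s).2 (Or.inl hs))
  have b2 := (h2.2 t).1 ((h1.2 t).2 (Or.inr ht))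
  have b3 := (h1.2 s').1 ((h2.2 s').2 (Or.inl hs'))
  have b4 := (h1.2 t').1 ((h2.2 t').2 (Or.inr ht'))
  have c1 := b1.imp hs.inj hs.inj
  have c2 := b2.imp ht.inj ht.inj
  have c3 := b3.imp hs'.inj hs'.inj
  have c4 := b4.imp ht'.inj ht'.inj
  grind

theorem isOrdPair_unique {p q x y : C} (h1 : IsOrdPair E A p x y) (h2 : IsOrdPair E A q x y) :
    p = q :=
  h.ext p q h1.1 h2.1 fun z => (h1.2 z).trans (h2.2 z).symm

/-! ### Definability of the set-theoretic notions -/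

theorem dfn_isPair {f g k : Γ → C} (hf : Tm K M f) (hg : Tm K M g) (hk : Tm K M k) :
    Dfn K M (fun γ => IsPair E A (f γ) (g γ) (k γ)) := by
  refine Dfn.comp₃ (P := IsPair E A) ?_ hf hg hk
  unfold IsPair
  apply_rules (maxDepth := 1000) [Dfn.not, Dfn.and, Dfn.or, Dfn.iff, Dfn.all, h.mem, h.atom,
    Dfn.eq, Tm.id, Tm.fst, Tm.snd]

theorem dfn_isOrdPair {f g k : Γ → C} (hf : Tm K M f) (hg : Tm K M g) (hk : Tm K M k) :
    Dfn K M (fun γ => IsOrdPair E A (f γ) (g γ) (k γ)) := by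
  refine Dfn.comp₃ (P := IsOrdPair E A) ?_ hf hg hk
  unfold IsOrdPair
  apply_rules (maxDepth := 1000) [h.dfn_isPair, Dfn.eq, Dfn.not, Dfn.and, Dfn.or, Dfn.iff, Dfn.all,
    h.mem, h.atom, Tm.id, Tm.fst, Tm.snd]

theorem dfn_ordPairMem {f g k : Γ → C} (hf : Tm K M f) (hg : Tm K M g) (hk : Tm K M k) :
    Dfn K M (fun γ => OrdPairMem E A (f γ) (g γ) (k γ)) := by
  refine Dfn.comp₃ (P := OrdPairMem E A) ?_ hf hg hk
  unfold OrdPairMem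
  apply_rules (maxDepth := 1000) [h.dfn_isOrdPair, Dfn.and, Dfn.ex, h.mem, Tm.id, Tm.fst, Tm.snd]

theorem dfn_zeroOrSucc {f : Γ → C} (hf : Tm K M f) :
    Dfn K M (fun γ => ZeroOrSucc E A (f γ)) := by
  refine Dfn.comp (P := ZeroOrSucc E A) ?_ hf
  unfold ZeroOrSucc
  apply_rules (maxDepth := 1000) [Dfn.not, Dfn.and, Dfn.or, Dfn.iff, Dfn.all, Dfn.ex, h.mem,
    h.atom, Dfn.eq, Tm.id, Tm.fst, Tm.snd]

theorem dfn_isTrans {f : Γ → C} (hf : Tm K M f) : Dfn K M (fun γ => IsTrans E (f γ)) := by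
  refine Dfn.comp (P := IsTrans E) ?_ hf
  unfold IsTrans
  apply_rules (maxDepth := 1000) [Dfn.all, h.mem, Tm.id, Tm.fst, Tm.snd, Dfn.imp]

theorem dfn_isNat {f : Γ → C} (hf : Tm K M f) : Dfn K M (fun γ => IsNat E A (f γ)) := by
  refine Dfn.comp (P := IsNat E A) ?_ hf
  unfold IsNat
  apply_rules (maxDepth := 1000) [h.dfn_isTrans, h.dfn_zeroOrSucc, Dfn.and, Dfn.all, h.mem, Tm.id,
    Tm.fst, Tm.snd, Dfn.imp]

theorem dfn_isBij {f g k : Γ → C} (hf : Tm K M f) (hg : Tm K M g) (hk : Tm K M k) :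
    Dfn K M (fun γ => IsBij E A (f γ) (g γ) (k γ)) := by
  refine Dfn.comp₃ (P := IsBij E A) ?_ hf hg hk
  unfold IsBij
  apply_rules (maxDepth := 1000) [h.dfn_isOrdPair, h.dfn_ordPairMem, Dfn.not, Dfn.and, Dfn.all,
    Dfn.ex, h.mem, h.atom, Dfn.eq, Tm.id, Tm.fst, Tm.snd, Dfn.imp]

theorem _root_.SchemeDef.IsBij.mem_of_ordPairMem {f m a x y : C} (hf : IsBij E A f m a)
    (hxy : OrdPairMem E A f x y) : E x m ∧ E y a := by
  obtain ⟨p, hp, hp'⟩ := hxy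
  obtain ⟨x', y', hm, hp''⟩ := hf.1.1.2 p hp
  obtain ⟨rfl, rfl⟩ := h.isOrdPair_inj hp' hp''
  exact hm

/-- Induction along the insertion of elements into sets. -/
theorem set_ind {P : C → Prop} (hP : Dfn K M P) (empty : ∀ a, ¬ A a → (∀ z, ¬ E z a) → P a)
    (insert : ∀ a x c, ¬ A a → ¬ A c → (∀ z, E z c ↔ E z a ∨ z = x) → P a → P c) (a : C)
    (ha : ¬ A a) : P a := by
  -- The induction is on the length `n`. The bijection and the set are quantified inside the
  -- predicate, since definability admits no first-order parameters.
  have main : ∀ n, ∀ f a, IsNat E A n → ¬ A a → IsBij E A f n a → P a := by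
    refine h.ind _ ?_ ?_
    · refine Dfn.all (Dfn.all ((h.dfn_isNat Tm.id.fst.fst).imp ((h.atom Tm.id.snd).not.imp
        ((h.dfn_isBij Tm.id.fst.snd Tm.id.fst.fst Tm.id.snd).imp (hP.comp Tm.id.snd)))))
    intro n ih f a hn ha hf
    rcases hn.1.2.2 with hz | ⟨k, hk⟩
    · refine empty a ha fun y hy => ?_
      obtain ⟨x, hx, -⟩ := hf.2 y hy
      exact hz x (hf.mem_of_ordPairMem h hx).1
    have hkn : E k n := (hk k).2 (Or.inr rfl)
    obtain ⟨y, hky, hy⟩ := hf.1.2 k hkn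
    have hya := (hf.mem_of_ordPairMem h hky).2
    obtain ⟨p, hpf, hp⟩ := id hky
    -- With `n = k ∪ {k}` and `y` the image of `k`, removing `y` from `a` and `⟨k, y⟩` from `f`
    -- leaves a bijection from `k` to `c = a \ {y}`.
    obtain ⟨c, hc, hc'⟩ := h.exists_erase a y
    obtain ⟨g, hg, hg'⟩ := h.exists_erase f p
    have hinj : ∀ x, OrdPairMem E A f x y → x = k := by
      intro x hx
      obtain ⟨x', -, hx'⟩ := hf.2 y hya
      rw [hx' x hx, hx' k hky]
    have hgf : ∀ u v, OrdPairMem E A g u v ↔ OrdPairMem E A f u v ∧ u ≠ k := by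
      intro u v
      constructor
      · rintro ⟨q, hq, hq'⟩
        obtain ⟨hq1, hq2⟩ := (hg' q).1 hq
        refine ⟨⟨q, hq1, hq'⟩, ?_⟩
        rintro rfl
        obtain rfl := hy v ⟨q, hq1, hq'⟩
        exact hq2 (h.isOrdPair_unique hq' hp)
      · rintro ⟨⟨q, hq, hq'⟩, hu⟩
        refine ⟨q, (hg' q).2 ⟨hq, ?_⟩, hq'⟩
        rintro rfl
        exact hu (h.isOrdPair_inj hq' hp).1
    have hkk := h.mem_irrefl k
    have hkn' : ∀ x, E x k ↔ E x n ∧ x ≠ k := by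
      intro x
      rw [hk]
      constructor
      · exact fun hx => ⟨Or.inl hx, fun e => hkk (e ▸ hx)⟩
      · exact fun hx => hx.1.resolve_right hx.2
    have hknat : IsNat E A k :=
      ⟨hn.2 k hkn, fun y hy => hn.2 y ((hk y).2 (Or.inl hy))⟩
    refine insert c y a hc ha (fun z => ?_) (ih k hkn g c hknat hc ⟨⟨⟨hg, ?_⟩, ?_⟩, ?_⟩)
    · rw [hc']
      constructor
      · intro hz
        by_cases e : z = y
        · exact Or.inr e
        · exact Or.inl ⟨hz, e⟩
      · rintro (hz | rfl)
        · exact hz.1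
        · exact hya
    · intro q hq
      obtain ⟨hq1, hq2⟩ := (hg' q).1 hq
      obtain ⟨u, v, ⟨hu, hv⟩, huv⟩ := hf.1.1.2 q hq1
      have huv' := ((hgf u v).1 ⟨q, hq, huv⟩).2
      refine ⟨u, v, ⟨(hkn' u).2 ⟨hu, huv'⟩, (hc' v).2 ⟨hv, ?_⟩⟩, huv⟩
      rintro rfl
      exact huv' (hinj u ⟨q, hq1, huv⟩)
    · intro x hx
      obtain ⟨hx1, hx2⟩ := (hkn' x).1 hx
      obtain ⟨v, hv, hv'⟩ := hf.1.2 x hx1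
      exact ⟨v, (hgf x v).2 ⟨hv, hx2⟩, fun z hz => hv' z ((hgf x z).1 hz).1⟩
    · intro v hv
      obtain ⟨hv1, hv2⟩ := (hc' v).1 hv
      obtain ⟨u, hu, hu'⟩ := hf.2 v hv1
      refine ⟨u, (hgf u v).2 ⟨hu, ?_⟩, fun z hz => hu' z ((hgf z v).1 hz).1⟩
      rintro rfl
      exact hv2 (hy v hu)
  obtain ⟨n, f, hn, hf⟩ := h.finite a ha
  exact main n f a hn ha hf

/-- Induction along the construction of hereditarily finite sets from atoms. -/
theorem hf_ind {P : C → Prop} (hP : Dfn K M P) (atom : ∀ a, A a → P a)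
    (empty : ∀ a, ¬ A a → (∀ z, ¬ E z a) → P a)
    (insert : ∀ a x c, ¬ A a → ¬ A c → (∀ z, E z c ↔ E z a ∨ z = x) → P a → P x → P c)
    (a : C) : P a := by
  refine h.ind P hP (fun x hx => ?_) a
  by_cases hA : A x
  · exact atom x hA
  -- Adjunction induction is applied to the implication "if all elements of `b` satisfy `P`, so does
  -- `b`"; its premise passes to subsets and supplies `P` for the adjoined element.
  refine h.set_ind (P := fun b => (∀ y, E y b → P y) → P b) ?_ ?_ ?_ x hA hx
  · exact (Dfn.all ((h.mem Tm.id.snd Tm.id.fst).imp (hP.comp Tm.id.snd))).imp hP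
  · exact fun b hb hb' _ => empty b hb hb'
  · intro b y c hb hc hbc ih hy
    exact insert b y c hb hc hbc (ih fun z hz => hy z ((hbc z).2 (Or.inl hz)))
      (hy y ((hbc y).2 (Or.inr rfl)))

/-- A set has a largest element among its atoms below a given atom, if there are any. -/
theorem exists_max_below (s : C) (hs : ¬ A s) (c : C) (hc : A c) :
    (∀ x, E x s → ¬ lt x c) ∨
      ∃ x, E x s ∧ lt x c ∧ ∀ y, E y s → lt y c → lt y x ∨ y = x := by
  -- The bound `c` has to be inside the predicate, again for want of parameters.
  revert c
  refine h.set_ind (P := fun s => ∀ c, A c → (∀ x, E x s → ¬ lt x c) ∨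
      ∃ x, E x s ∧ lt x c ∧ ∀ y, E y s → lt y c → lt y x ∨ y = x) ?_ ?_ ?_ s hs
  · apply_rules (maxDepth := 1000) [Dfn.not, Dfn.and, Dfn.or, Dfn.all, Dfn.ex, h.mem, h.atom, h.lt_dfn, Dfn.eq,
      Tm.id, Tm.fst, Tm.snd, Dfn.imp]
  · exact fun a _ ha c _ => Or.inl fun x hx => absurd hx (ha x)
  intro a x b ha hb hab ih c hc
  by_cases hxc : lt x c
  · have hA := h.atom_of_lt x c hxc
    refine Or.inr ?_
    rcases ih c hc with ih | ⟨w, hw, hwc, hmax⟩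
    · refine ⟨x, (hab x).2 (Or.inr rfl), hxc, fun y hy hyc => Or.inr ?_⟩
      exact ((hab y).1 hy).resolve_left fun hy' => ih y hy' hyc
    · have hA' := h.atom_of_lt w c hwc
      rcases h.lt_trichotomy x hA.1 w hA'.1 with hxw | rfl | hxw
      · refine ⟨w, (hab w).2 (Or.inl hw), hwc, fun y hy hyc => ?_⟩
        rcases (hab y).1 hy with hy | rfl
        · exact hmax y hy hyc
        · exact Or.inl hxw
      · refine ⟨x, (hab x).2 (Or.inr rfl), hxc, fun y hy hyc => ?_⟩
        rcases (hab y).1 hy with hy | rfl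
        · exact hmax y hy hyc
        · exact Or.inr rfl
      · refine ⟨x, (hab x).2 (Or.inr rfl), hxc, fun y hy hyc => ?_⟩
        rcases (hab y).1 hy with hy | rfl
        · rcases hmax y hy hyc with hyw | rfl
          · exact Or.inl (h.lt_trans y (h.atom_of_lt y c hyc).1 w hA'.1 x hA.1 hyw hxw)
          · exact Or.inl hxw
        · exact Or.inr rfl
  · rcases ih c hc with ih | ⟨w, hw, hwc, hmax⟩
    · refine Or.inl fun y hy => ?_
      rcases (hab y).1 hy with hy | rfl
      · exact ih y hy
      · exact hxc
    · refine Or.inr ⟨w, (hab w).2 (Or.inl hw), hwc, fun y hy hyc => ?_⟩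
      rcases (hab y).1 hy with hy | rfl
      · exact hmax y hy hyc
      · exact absurd hyc hxc

/-- Reversing the order of the atoms. -/
theorem swap : IsHF K M E A (fun x y => lt y x) :=
  { h with
    dfn_lt := h.lt_dfn Tm.id.snd Tm.id.fst
    atom_of_lt := fun x y hxy => (h.atom_of_lt y x hxy).symm
    lt_trans := fun x hx y hy z hz hxy hyz => h.lt_trans z hz y hy x hx hyz hxy
    lt_trichotomy := fun x hx y hy => by
      rcases h.lt_trichotomy x hx y hy with h | h | h
      · exact Or.inr (Or.inr h)
      · exact Or.inr (Or.inl h)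
      · exact Or.inl h
    dense := fun x hx y hy hxy => by
      obtain ⟨z, hz, h1, h2⟩ := h.dense y hy x hx hxy
      exact ⟨z, hz, h2, h1⟩
    exists_gt := h.exists_lt
    exists_lt := h.exists_gt }

end IsHF

section

/-! ## Partial isomorphisms with transitive finite domain -/

/-- `r` is the graph of a partial isomorphism whose domain and range are transitive and are
the extensions of sets. -/
structure IsPIso {C D : Type u} (E : C → C → Prop) (A : C → Prop) (lt : C → C → Prop)
    (E' : D → D → Prop) (A' : D → Prop) (lt' : D → D → Prop) (r : C → D → Prop) : Prop where
  func : ∀ c d d', r c d → r c d' → d = d'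
  inj : ∀ c c' d, r c d → r c' d → c = c'
  mem : ∀ c d c' d', r c d → r c' d' → (E c c' ↔ E' d d')
  atom : ∀ c d, r c d → (A c ↔ A' d)
  lt : ∀ c d c' d', r c d → r c' d' → (lt c c' ↔ lt' d d')
  closed : ∀ c d c', r c d → E c' c → ∃ d', r c' d'
  closed' : ∀ c d d', r c d → E' d' d → ∃ c', r c' d'
  dom : ∃ a, ¬ A a ∧ ∀ c, E c a ↔ ∃ d, r c d
  ran : ∃ b, ¬ A' b ∧ ∀ d, E' d b ↔ ∃ c, r c d

variable {K : FirstOrder.Language.{0, u}} {M : Type u} [K.Structure M] {B C D : Type u}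
  [Coded K M B] [Coded K M C] [Coded K M D] {E : C → C → Prop} {A : C → Prop} {lt : C → C → Prop}
  {E' : D → D → Prop} {A' : D → Prop} {lt' : D → D → Prop}

theorem IsPIso.symm {r : C → D → Prop} (hr : IsPIso E A lt E' A' lt' r) :
    IsPIso E' A' lt' E A lt (fun d c => r c d) where
  func d c c' h h' := hr.inj c c' d h h'
  inj d d' c h h' := hr.func c d d' h h'
  mem d c d' c' h h' := (hr.mem c d c' d' h h').symm
  atom d c h := (hr.atom c d h).symm
  lt d c d' c' h h' := (hr.lt c d c' d' h h').symm
  closed d c d' h h' := hr.closed' c d d' h h'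
  closed' d c c' h h' := hr.closed c d c' h h'
  dom := hr.ran
  ran := hr.dom

theorem IsPIso.swap {r : C → D → Prop} (hr : IsPIso E A lt E' A' lt' r) :
    IsPIso E A (fun x y => lt y x) E' A' (fun x y => lt' y x) r :=
  { hr with lt := fun c d c' d' h h' => hr.lt c' d' c d h' h }

/-- The empty relation is a partial isomorphism. -/
theorem isPIso_empty (h : IsHF K M E A lt) (h' : IsHF K M E' A' lt') {r : C → D → Prop}
    (hr : ∀ c d, ¬ r c d) : IsPIso E A lt E' A' lt' r where
  func c d d' h := absurd h (hr c d)
  inj c c' d h := absurd h (hr c d)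
  mem c d c' d' h := absurd h (hr c d)
  atom c d h := absurd h (hr c d)
  lt c d c' d' h := absurd h (hr c d)
  closed c d c' h := absurd h (hr c d)
  closed' c d c' h := absurd h (hr c d)
  dom := by
    obtain ⟨e, he, he'⟩ := h.exists_empty
    exact ⟨e, he, fun c => ⟨fun hc => absurd hc (he' c), fun ⟨d, hd⟩ => absurd hd (hr c d)⟩⟩
  ran := by
    obtain ⟨e, he, he'⟩ := h'.exists_empty
    exact ⟨e, he, fun c => ⟨fun hc => absurd hc (he' c), fun ⟨d, hd⟩ => absurd hd (hr d c)⟩⟩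

/-- Extension of a partial isomorphism by one pair. -/
theorem IsPIso.extend (h : IsHF K M E A lt) (h' : IsHF K M E' A' lt') {r r' : C → D → Prop}
    (hr : IsPIso E A lt E' A' lt' r) {c : C} {d : D} (hc : ∀ y, ¬ r c y) (hd : ∀ x, ¬ r x d)
    (hr' : ∀ x y, r' x y ↔ r x y ∨ x = c ∧ y = d) (hmem : ∀ x y, r x y → (E x c ↔ E' y d))
    (hsub : ∀ x, E x c → ∃ y, r x y) (hsub' : ∀ y, E' y d → ∃ x, r x y) (hatom : A c ↔ A' d)
    (hlt : ∀ x y, r x y → (lt x c ↔ lt' y d)) (hlt' : ∀ x y, r x y → (lt c x ↔ lt' d y)) :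
    IsPIso E A lt E' A' lt' r' where
  func x y y' h1 h2 := by
    rcases (hr' _ _).1 h1 with h1 | ⟨rfl, rfl⟩ <;> rcases (hr' _ _).1 h2 with h2 | ⟨h2, rfl⟩
    · exact hr.func x y y' h1 h2
    · exact absurd (h2 ▸ h1) (hc y)
    · exact absurd h2 (hc y')
    · rfl
  inj x x' y h1 h2 := by
    rcases (hr' _ _).1 h1 with h1 | ⟨rfl, rfl⟩ <;> rcases (hr' _ _).1 h2 with h2 | ⟨rfl, h2⟩
    · exact hr.inj x x' y h1 h2
    · exact absurd (h2 ▸ h1) (hd x)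
    · exact absurd h2 (hd x')
    · rfl
  mem x y x' y' h1 h2 := by
    rcases (hr' _ _).1 h1 with h1 | ⟨rfl, rfl⟩ <;> rcases (hr' _ _).1 h2 with h2 | ⟨rfl, rfl⟩
    · exact hr.mem x y x' y' h1 h2
    · exact hmem x y h1
    -- The old domain and range are transitive, so the new `c` and `d` belong to none of their
    -- elements.
    · exact iff_of_false (fun e => (hr.closed x' y' x h2 e).elim hc)
        (fun e => (hr.closed' x' y' y h2 e).elim hd)
    · exact iff_of_false (h.mem_irrefl _) (h'.mem_irrefl _)
  atom x y h1 := by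
    rcases (hr' _ _).1 h1 with h1 | ⟨rfl, rfl⟩
    · exact hr.atom x y h1
    · exact hatom
  lt x y x' y' h1 h2 := by
    rcases (hr' _ _).1 h1 with h1 | ⟨rfl, rfl⟩ <;> rcases (hr' _ _).1 h2 with h2 | ⟨rfl, rfl⟩
    · exact hr.lt x y x' y' h1 h2
    · exact hlt x y h1
    · exact hlt' x' y' h2
    · exact iff_of_false (fun e => h.lt_irrefl _ (h.atom_of_lt _ _ e).1 e)
        (fun e => h'.lt_irrefl _ (h'.atom_of_lt _ _ e).1 e)
  closed x y z h1 h2 := by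
    have : ∃ w, r z w := by
      rcases (hr' _ _).1 h1 with h1 | ⟨rfl, rfl⟩
      · exact hr.closed x y z h1 h2
      · exact hsub z h2
    exact this.imp fun w hw => (hr' z w).2 (Or.inl hw)
  closed' x y z h1 h2 := by
    have : ∃ w, r w z := by
      rcases (hr' _ _).1 h1 with h1 | ⟨rfl, rfl⟩
      · exact hr.closed' x y z h1 h2
      · exact hsub' z h2
    exact this.imp fun w hw => (hr' w z).2 (Or.inl hw)
  dom := by
    obtain ⟨a, -, ha'⟩ := hr.dom
    obtain ⟨b, hb, hb'⟩ := h.exists_insert a c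
    refine ⟨b, hb, fun z => ?_⟩
    rw [hb', ha']
    constructor
    · rintro (⟨w, hw⟩ | rfl)
      · exact ⟨w, (hr' _ _).2 (Or.inl hw)⟩
      · exact ⟨d, (hr' _ _).2 (Or.inr ⟨rfl, rfl⟩)⟩
    · rintro ⟨w, hw⟩
      exact ((hr' _ _).1 hw).imp (fun e => ⟨w, e⟩) And.left
  ran := by
    obtain ⟨a, -, ha'⟩ := hr.ran
    obtain ⟨b, hb, hb'⟩ := h'.exists_insert a d
    refine ⟨b, hb, fun z => ?_⟩
    rw [hb', ha']
    constructor
    · rintro (⟨w, hw⟩ | rfl)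
      · exact ⟨w, (hr' _ _).2 (Or.inl hw)⟩
      · exact ⟨c, (hr' _ _).2 (Or.inr ⟨rfl, rfl⟩)⟩
    · rintro ⟨w, hw⟩
      exact ((hr' _ _).1 hw).imp (fun e => ⟨w, e⟩) And.right

/-- Extension of a partial isomorphism to a set whose elements are in the domain. -/
theorem IsPIso.extend_set (h : IsHF K M E A lt) (h' : IsHF K M E' A' lt') {r r' : C → D → Prop}
    (hr : IsPIso E A lt E' A' lt' r) {c : C} {d : D} (hc : ∀ y, ¬ r c y)
    (hr' : ∀ x y, r' x y ↔ r x y ∨ x = c ∧ y = d) (hA : ¬ A c) (hA' : ¬ A' d)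
    (hsub : ∀ x, E x c → ∃ y, r x y) (hd : ∀ y, E' y d ↔ ∃ x, E x c ∧ r x y) :
    IsPIso E A lt E' A' lt' r' := by
  have hmem : ∀ x y, r x y → (E x c ↔ E' y d) := by
    intro x y hxy
    rw [hd]
    constructor
    · exact fun hx => ⟨x, hx, hxy⟩
    · rintro ⟨x', hx', hxy'⟩
      rwa [hr.inj x x' y hxy hxy']
  refine hr.extend h h' hc (fun x hx => ?_) hr' hmem hsub (fun y hy => ?_)
    (iff_of_false hA hA') (fun x y hxy => iff_of_false (fun e => hA (h.atom_of_lt _ _ e).2)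
      fun e => hA' (h'.atom_of_lt _ _ e).2) (fun x y hxy => iff_of_false
      (fun e => hA (h.atom_of_lt _ _ e).1) fun e => hA' (h'.atom_of_lt _ _ e).1)
  -- The point `d` is new: a preimage `x` of `d` would have the same elements as `c`, hence equal
  -- `c` by extensionality.
  · have : x = c := by
      refine h.ext x c (fun e => hA' ((hr.atom x d hx).1 e)) hA fun z => ?_
      constructor
      · intro hz
        obtain ⟨w, hw⟩ := hr.closed x d z hx hz
        exact (hmem z w hw).2 ((hr.mem z w x d hw hx).1 hz)
      · intro hz
        obtain ⟨w, hw⟩ := hsub z hz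
        exact (hr.mem z w x d hw hx).2 ((hmem z w hw).1 hz)
    exact hc d (this ▸ hx)
  · obtain ⟨x, -, hx⟩ := (hd y).1 hy
    exact ⟨x, hx⟩

/-- For an atom `c`, the images of the atoms below `c` are bounded by the image of one of them,
unless there are none. -/
theorem IsPIso.exists_bound_below (h : IsHF K M E A lt) (h' : IsHF K M E' A' lt')
    {r : C → D → Prop} (hr : IsPIso E A lt E' A' lt' r) {c : C} (hA : A c) :
    (∀ x y, r x y → ¬ lt x c) ∨ ∃ x y, r x y ∧ lt x c ∧ A' y ∧
      ∀ d, A' d → lt' y d → ∀ x' y', r x' y' → lt x' c → lt' y' d := by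
  obtain ⟨s, hs, hs'⟩ := hr.dom
  rcases h.exists_max_below s hs c hA with hb | ⟨x, hx, hxc, hmax⟩
  · exact Or.inl fun x y hxy => hb x ((hs' x).2 ⟨y, hxy⟩)
  · obtain ⟨y, hxy⟩ := (hs' x).1 hx
    have hy := (hr.atom x y hxy).1 (h.atom_of_lt _ _ hxc).1
    refine Or.inr ⟨x, y, hxy, hxc, hy, fun d hd hyd x' y' hxy' hxc' => ?_⟩
    rcases hmax x' ((hs' x').2 ⟨y', hxy'⟩) hxc' with e | rfl
    · have e' := (hr.lt x' y' x y hxy' hxy).1 e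
      exact h'.lt_trans y' (h'.atom_of_lt _ _ e').1 y hy d hd e' hyd
    · rwa [hr.func x' y' y hxy' hxy]

/-- Below `c` only the largest atom of the domain matters, above `c` only the smallest, and their
images keep their order. If both exist, density gives `d` between the images; if one is missing, the
absence of an endpoint does; if both are missing, any atom will do. The upper bound comes from
reversing the orders. -/
theorem IsPIso.exists_atom_image (h : IsHF K M E A lt) (h' : IsHF K M E' A' lt')
    {r : C → D → Prop} (hr : IsPIso E A lt E' A' lt' r) {c : C} (hA : A c) :
    ∃ d, A' d ∧ (∀ x y, r x y → lt x c → lt' y d) ∧ ∀ x y, r x y → lt c x → lt' d y := by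
  rcases hr.exists_bound_below h h' hA with h1 | ⟨x, y, hxy, hxc, hy, h1⟩ <;>
    rcases hr.swap.exists_bound_below h.swap h'.swap hA with h2 | ⟨z, w, hzw, hzc, hw, h2⟩
  · obtain ⟨d, hd⟩ := h'.exists_atom
    exact ⟨d, hd, fun x y hxy e => absurd e (h1 x y hxy), fun x y hxy e => absurd e (h2 x y hxy)⟩
  · obtain ⟨d, hd, hdw⟩ := h'.exists_lt w hw
    exact ⟨d, hd, fun x y hxy e => absurd e (h1 x y hxy), h2 d hd hdw⟩
  · obtain ⟨d, hd, hdy⟩ := h'.exists_gt y hy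
    exact ⟨d, hd, h1 d hd hdy, fun x y hxy e => absurd e (h2 x y hxy)⟩
  · have hxz := h.lt_trans x (h.atom_of_lt _ _ hxc).1 c hA z (h.atom_of_lt _ _ hzc).2 hxc hzc
    obtain ⟨d, hd, hyd, hdw⟩ := h'.dense y hy w hw ((hr.lt x y z w hxy hzw).1 hxz)
    exact ⟨d, hd, h1 d hd hyd, h2 d hd hdw⟩

/-- Extension of a partial isomorphism to an atom. -/
theorem IsPIso.extend_atom (h : IsHF K M E A lt) (h' : IsHF K M E' A' lt') {r : C → D → Prop}
    (hr : IsPIso E A lt E' A' lt' r) {c : C} (hc : ∀ y, ¬ r c y) (hA : A c) :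
    ∃ d, ∀ r' : C → D → Prop, (∀ x y, r' x y ↔ r x y ∨ x = c ∧ y = d) →
      IsPIso E A lt E' A' lt' r' := by
  obtain ⟨d, hd, h1, h2⟩ := hr.exists_atom_image h h' hA
  have tri : ∀ x y, r x y → A x → lt x c ∨ lt c x := by
    intro x y hxy hx
    rcases h.lt_trichotomy x hx c hA with e | rfl | e
    · exact Or.inl e
    · exact absurd hxy (hc y)
    · exact Or.inr e
  have asymm : ∀ y, lt' y d → lt' d y → False := fun y e e' =>
    h'.lt_irrefl d hd (h'.lt_trans d hd y (h'.atom_of_lt _ _ e).1 d hd e' e)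
  refine ⟨d, fun r' hr' => hr.extend h h' hc (fun x hx => ?_) hr'
    (fun x y _ => iff_of_false (h.not_mem_atom c hA x) (h'.not_mem_atom d hd y))
    (fun x e => absurd e (h.not_mem_atom c hA x)) (fun x e => absurd e (h'.not_mem_atom d hd x))
    (iff_of_true hA hd) (fun x y hxy => ⟨h1 x y hxy, fun e => ?_⟩)
    (fun x y hxy => ⟨h2 x y hxy, fun e => ?_⟩)⟩
  · rcases tri x d hx ((hr.atom x d hx).2 hd) with e | e
    · exact h'.lt_irrefl d hd (h1 x d hx e)
    · exact h'.lt_irrefl d hd (h2 x d hx e)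
  · refine (tri x y hxy ((hr.atom x y hxy).2 (h'.atom_of_lt _ _ e).1)).resolve_right fun e' => ?_
    exact asymm y e (h2 x y hxy e')
  · refine (tri x y hxy ((hr.atom x y hxy).2 (h'.atom_of_lt _ _ e).2)).resolve_left fun e' => ?_
    exact asymm y (h1 x y hxy e') e

/-! ## Coded relations -/

variable (K M) in
/-- A definable family of relations that contains the empty one and is closed under adding a
pair. -/
structure IsRelCode (S : B → C → D → Prop) : Prop where
  dfn : Dfn K M (fun p : B × C × D => S p.1 p.2.1 p.2.2)
  empty : ∃ m, ∀ c d, ¬ S m c d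
  insert : ∀ m x y, ∃ m', ∀ c d, S m' c d ↔ S m c d ∨ c = x ∧ d = y

variable {S : B → C → D → Prop}

theorem IsRelCode.symm (hS : IsRelCode K M S) : IsRelCode K M (fun m d c => S m c d) where
  dfn := hS.dfn.comp (Tm.id.fst.pair (Tm.id.snd.snd.pair Tm.id.snd.fst))
  empty := hS.empty.imp fun _ h d c => h c d
  insert m d c := (hS.insert m c d).imp fun _ h d' c' => by rw [h, and_comm]

theorem IsRelCode.app (hS : IsRelCode K M S) {Γ : Type u} [Coded K M Γ] {f : Γ → B} {g : Γ → C}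
    {k : Γ → D} (hf : Tm K M f) (hg : Tm K M g) (hk : Tm K M k) :
    Dfn K M (fun γ => S (f γ) (g γ) (k γ)) :=
  hS.dfn.comp₃ hf hg hk

/-- This is what allows partial isomorphisms to be quantified over in induction hypotheses: all the
clauses are first-order in the code. -/
theorem IsRelCode.dfn_isPIso (hS : IsRelCode K M S) (h : IsHF K M E A lt)
    (h' : IsHF K M E' A' lt') {Γ : Type u} [Coded K M Γ] {f : Γ → B} (hf : Tm K M f) :
    Dfn K M (fun γ => IsPIso E A lt E' A' lt' (S (f γ))) := by
  refine Dfn.comp (P := fun m => IsPIso E A lt E' A' lt' (S m)) ?_ hf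
  have e : (fun m => IsPIso E A lt E' A' lt' (S m)) = fun m =>
      (∀ c d d', S m c d → S m c d' → d = d') ∧
      (∀ c c' d, S m c d → S m c' d → c = c') ∧
      (∀ c d c' d', S m c d → S m c' d' → (E c c' ↔ E' d d')) ∧
      (∀ c d, S m c d → (A c ↔ A' d)) ∧
      (∀ c d c' d', S m c d → S m c' d' → (lt c c' ↔ lt' d d')) ∧
      (∀ c d c', S m c d → E c' c → ∃ d', S m c' d') ∧
      (∀ c d d', S m c d → E' d' d → ∃ c', S m c' d') ∧
      (∃ a, ¬ A a ∧ ∀ c, E c a ↔ ∃ d, S m c d) ∧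
      (∃ b, ¬ A' b ∧ ∀ d, E' d b ↔ ∃ c, S m c d) := by
    funext m
    exact propext ⟨fun ⟨h1, h2, h3, h4, h5, h6, h7, h8, h9⟩ =>
      ⟨h1, h2, h3, h4, h5, h6, h7, h8, h9⟩, fun ⟨h1, h2, h3, h4, h5, h6, h7, h8, h9⟩ =>
      ⟨h1, h2, h3, h4, h5, h6, h7, h8, h9⟩⟩
  rw [e]
  apply_rules (maxDepth := 1000) [hS.app, h.mem, h'.mem, h.atom, h'.atom, h.lt_dfn, h'.lt_dfn,
    Dfn.eq, Dfn.not, Dfn.and, Dfn.iff, Dfn.all, Dfn.ex, Tm.id, Tm.fst, Tm.snd, Dfn.imp]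

/-- Coded partial isomorphisms can be extended to every element. -/
theorem IsRelCode.forth (hS : IsRelCode K M S) (h : IsHF K M E A lt) (h' : IsHF K M E' A' lt')
    (c : C) : ∀ m, IsPIso E A lt E' A' lt' (S m) → ∃ m', IsPIso E A lt E' A' lt' (S m') ∧
      (∀ x y, S m x y → S m' x y) ∧ ∃ d, S m' c d := by
  -- The quantifier over `m` stands inside the predicate: it keeps the predicate free of parameters,
  -- and the insertion case uses the hypothesis for `x` at a code other than `m`.
  refine h.hf_ind (P := fun c => ∀ m, IsPIso E A lt E' A' lt' (S m) →
    ∃ m', IsPIso E A lt E' A' lt' (S m') ∧ (∀ x y, S m x y → S m' x y) ∧ ∃ d, S m' c d)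
    ?_ ?_ ?_ ?_ c
  · have := fun (Γ : Type u) [Coded K M Γ] (f : Γ → B) (hf : Tm K M f) =>
      hS.dfn_isPIso h h' hf
    apply_rules (maxDepth := 1000) [this, hS.app, Dfn.and, Dfn.all, Dfn.ex, Tm.id, Tm.fst, Tm.snd,
      Dfn.imp]
  · intro c hA m hm
    by_cases hc : ∃ d, S m c d
    · exact ⟨m, hm, fun _ _ h => h, hc⟩
    obtain ⟨d, hd⟩ := hm.extend_atom h h' (not_exists.1 hc) hA
    obtain ⟨m', hm'⟩ := hS.insert m c d
    exact ⟨m', hd _ hm', fun x y e => (hm' x y).2 (Or.inl e), d, (hm' c d).2 (Or.inr ⟨rfl, rfl⟩)⟩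
  · intro c hA hempty m hm
    by_cases hc : ∃ d, S m c d
    · exact ⟨m, hm, fun _ _ h => h, hc⟩
    obtain ⟨d, hd, hd'⟩ := h'.exists_empty
    obtain ⟨m', hm'⟩ := hS.insert m c d
    refine ⟨m', hm.extend_set h h' (not_exists.1 hc) hm' hA hd
      (fun x hx => absurd hx (hempty x)) (fun y => iff_of_false (hd' y) ?_),
      fun x y e => (hm' x y).2 (Or.inl e), d, (hm' c d).2 (Or.inr ⟨rfl, rfl⟩)⟩
    rintro ⟨x, hx, -⟩
    exact hempty x hx
  · intro a x c ha hc hac iha ihx m hm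
    -- The map is extended first to `a`, then to `x`; transitivity of the domain and range ensures
    -- that the elements of `a` are matched with those of `b`, so `b ∪ {y}` is the right image of
    -- `c`.
    obtain ⟨m₁, hm₁, hle₁, b, hb⟩ := iha m hm
    obtain ⟨m₂, hm₂, hle₂, y, hy⟩ := ihx m₁ hm₁
    by_cases hc' : ∃ d, S m₂ c d
    · exact ⟨m₂, hm₂, fun u v e => hle₂ u v (hle₁ u v e), hc'⟩
    have hb₂ := hle₂ a b hb
    obtain ⟨d, hd, hd'⟩ := h'.exists_insert b y
    obtain ⟨m', hm'⟩ := hS.insert m₂ c d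
    refine ⟨m', hm₂.extend_set h h' (not_exists.1 hc') hm' hc hd (fun z hz => ?_) (fun z => ?_),
      fun u v e => (hm' u v).2 (Or.inl (hle₂ u v (hle₁ u v e))), d,
      (hm' c d).2 (Or.inr ⟨rfl, rfl⟩)⟩
    · rcases (hac z).1 hz with hz | rfl
      · exact hm₂.closed a b z hb₂ hz
      · exact ⟨y, hy⟩
    · rw [hd']
      constructor
      · rintro (hz | rfl)
        · obtain ⟨w, hw⟩ := hm₂.closed' a b z hb₂ hz
          exact ⟨w, (hac w).2 (Or.inl ((hm₂.mem w z a b hw hb₂).2 hz)), hw⟩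
        · exact ⟨x, (hac x).2 (Or.inr rfl), hy⟩
      · rintro ⟨w, hw, hwz⟩
        rcases (hac w).1 hw with hw | rfl
        · exact Or.inl ((hm₂.mem w z a b hwz hb₂).1 hw)
        · exact Or.inr (hm₂.func w z y hwz hy)

end

/-! ## Back-and-forth systems -/

/-- Induction on formulas, for all relations in `I` at once. Terms are variables because the
signature is relational. The family `I` is external, so no definability is required of it. -/
theorem elementarilyEquivalent_of_backAndForth {L : FirstOrder.Language.{0, 0}} [L.IsRelational]
    {C D : Type u} [L.Structure C] [L.Structure D] (I : Set (C → D → Prop)) (hI : I.Nonempty)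
    (eq : ∀ r ∈ I, ∀ c d c' d', r c d → r c' d' → (c = c' ↔ d = d'))
    (rel : ∀ r ∈ I, ∀ {n : ℕ} (R : L.Relations n) (v : Fin n → C) (w : Fin n → D),
      (∀ i, r (v i) (w i)) → (Structure.RelMap R v ↔ Structure.RelMap R w))
    (forth : ∀ r ∈ I, ∀ c, ∃ r' ∈ I, (∀ x y, r x y → r' x y) ∧ ∃ d, r' c d)
    (back : ∀ r ∈ I, ∀ d, ∃ r' ∈ I, (∀ x y, r x y → r' x y) ∧ ∃ c, r' c d) : C ≅[L] D := by
  have term : ∀ {n : ℕ} (t : L.Term (Empty ⊕ Fin n)), ∃ i, t = Term.var (Sum.inr i) := by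
    intro n t
    cases t with
    | var x =>
      rcases x with x | i
      · exact x.elim
      · exact ⟨i, rfl⟩
    | func f => exact isEmptyElim f
  have main : ∀ {n : ℕ} (φ : L.BoundedFormula Empty n), ∀ r ∈ I, ∀ (v : Fin n → C)
      (w : Fin n → D), (∀ i, r (v i) (w i)) → (φ.Realize default v ↔ φ.Realize default w) := by
    intro n φ
    induction φ with
    | falsum => exact fun _ _ _ _ _ => Iff.rfl
    | equal s t =>
      intro r hr v w hvw
      obtain ⟨i, rfl⟩ := term s
      obtain ⟨j, rfl⟩ := term t
      exact eq r hr _ _ _ _ (hvw i) (hvw j)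
    | rel R ts =>
      intro r hr v w hvw
      refine rel r hr R _ _ fun k => ?_
      obtain ⟨i, hi⟩ := term (ts k)
      rw [hi]
      exact hvw i
    | imp _ _ ih₁ ih₂ => exact fun r hr v w hvw => imp_congr (ih₁ r hr v w hvw) (ih₂ r hr v w hvw)
    | all φ ih =>
      intro r hr v w hvw
      have snoc : ∀ r' : C → D → Prop, (∀ x y, r x y → r' x y) → ∀ c d, r' c d → ∀ i,
          r' (Fin.snoc (α := fun _ => C) v c i) (Fin.snoc (α := fun _ => D) w d i) := by
        intro r' hle c d hcd i
        refine Fin.lastCases ?_ (fun i => ?_) i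
        · simpa using hcd
        · simpa using hle _ _ (hvw i)
      constructor
      · intro h d
        obtain ⟨r', hr', hle, c, hcd⟩ := back r hr d
        exact (ih r' hr' _ _ (snoc r' hle c d hcd)).1 (h c)
      · intro h c
        obtain ⟨r', hr', hle, d, hcd⟩ := forth r hr c
        exact (ih r' hr' _ _ (snoc r' hle c d hcd)).2 (h d)
  obtain ⟨r, hr⟩ := hI
  exact elementarilyEquivalent_iff.2 fun φ => by
    have := main φ r hr default default (fun i => i.elim0)
    exact this

/-! ## Relations coded by sets of pairs in adjunctive set theory -/

section Adjunctive

variable {M : Type u} (e : M → M → Prop)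

/-- `z` is a Kuratowski pair of `x` and `y`, in the absence of extensionality. -/
def CodesPair (z x y : M) : Prop :=
  ∃ u v, (∀ w, e w u ↔ w = x) ∧ (∀ w, e w v ↔ w = x ∨ w = y) ∧ ∀ w, e w z ↔ w = u ∨ w = v

variable {e}

/-- Without extensionality a pair may have many codes, but the usual Kuratowski argument still
recovers the components from any one of them. -/
theorem CodesPair.inj {z x y x' y' : M} (h : CodesPair e z x y) (h' : CodesPair e z x' y') :
    x = x' ∧ y = y' := by
  obtain ⟨u, v, hu, hv, hz⟩ := h
  obtain ⟨u', v', hu', hv', hz'⟩ := h'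
  have a1 := (hz u').1 ((hz' u').2 (Or.inl rfl))
  have a2 := (hz v').1 ((hz' v').2 (Or.inr rfl))
  have a3 := (hz' u).1 ((hz u).2 (Or.inl rfl))
  have a4 := (hz' v).1 ((hz v).2 (Or.inr rfl))
  have b1 := (hu x).2 rfl
  have b2 := (hv x).2 (Or.inl rfl)
  have b3 := (hv y).2 (Or.inr rfl)
  have c1 := (hu' x').2 rfl
  have c2 := (hv' x').2 (Or.inl rfl)
  have c3 := (hv' y').2 (Or.inr rfl)
  grind

theorem exists_codesPair (hempty : ∃ x, ∀ y, ¬ e y x)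
    (hadj : ∀ x y, ∃ z, ∀ w, e w z ↔ e w x ∨ w = y) (x y : M) : ∃ z, CodesPair e z x y := by
  obtain ⟨o, ho⟩ := hempty
  obtain ⟨u, hu⟩ := hadj o x
  obtain ⟨v, hv⟩ := hadj u y
  obtain ⟨s, hs⟩ := hadj o u
  obtain ⟨z, hz⟩ := hadj s v
  refine ⟨z, u, v, fun w => ?_, fun w => ?_, fun w => ?_⟩
  · rw [hu, or_iff_right (ho w)]
  · rw [hv, hu, or_iff_right (ho w)]
  · rw [hz, hs, or_iff_right (ho w)]

theorem realize_emptySetAx [setLang.Structure M] :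
    M ⊨ emptySetAx ↔ ∃ x : M, ∀ y, ¬ Structure.RelMap setMem ![y, x] := by
  simp [emptySetAx, Sentence.Realize, Formula.Realize, Fin.snoc]

theorem realize_adjunctionAx [setLang.Structure M] :
    M ⊨ adjunctionAx ↔ ∀ x y : M, ∃ z, ∀ w, Structure.RelMap setMem ![w, z] ↔
      Structure.RelMap setMem ![w, x] ∨ w = y := by
  simp [adjunctionAx, Sentence.Realize, Formula.Realize, Fin.snoc]

theorem IsSPCModel.realize_of_ofSentence_mem {L : FirstOrder.Language.{0, 0}} [L.Structure M]
    {T : Set (Scheme L)} {X : Classes M} (hX : IsSPCModel T M X) {φ : L.Sentence}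
    (hφ : Scheme.ofSentence φ ∈ T) : M ⊨ φ := by
  -- A scheme without `P` still has to be instantiated by some class of arity `0`; comprehension for
  -- `⊤` provides one.
  let S : Set (Fin 0 → M) := {v | (⊤ : (L.sum (classLang X)).Formula (Fin 0)).Realize v}
  let _ := predStructure S
  exact (LHom.realize_onSentence (L' := L.sum (predLang 0)) M LHom.sumInl φ).1
    (hX.schemes _ hφ S (hX.comprehension _ ⊤))

end Adjunctive

namespace InternalStructure

variable {L L' : FirstOrder.Language.{0, 0}} {M : Type u} [L'.Structure M] {X : Classes M}
  (N : InternalStructure L X)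

/-- `m` represents the element `c` of the universe of `N`. -/
def Represents (m : M) (c : N.Carrier) : Prop := ∃ h : m ∈ N.dom, N.toCarrier ⟨m, h⟩ = c

/-- A code of `(m, c)` is `m` together with a representative of `c`, so the relation amounts to the
equality of `N` between the two entries. -/
theorem dfn_represents : Dfn (L'.sum (classLang X)) M
    (fun p : M × N.Carrier => N.Represents p.1 p.2) := by
  refine Dfn.of_definable (Coded.eq_definable (K := L'.sum (classLang X)) (S := N.Carrier))
    fun v => ?_
  constructor
  · rintro ⟨⟨m, c⟩, ⟨h1, h2⟩, h3⟩
    obtain rfl : _ = m := h1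
    exact ⟨c, h3, h2⟩
  · rintro ⟨c, h1, h2⟩
    exact ⟨(v (Sum.inl ()), c), ⟨rfl, h2⟩, h1⟩

theorem Represents.unique {m : M} {c c' : N.Carrier} (h : N.Represents m c)
    (h' : N.Represents m c') : c = c' := by
  obtain ⟨_, rfl⟩ := h
  obtain ⟨_, rfl⟩ := h'
  rfl

theorem exists_represents (c : N.Carrier) : ∃ m, N.Represents m c := by
  obtain ⟨m, rfl⟩ := Quotient.exists_rep c
  exact ⟨m, m.2, rfl⟩

end InternalStructure

/-! ### Elements of `M` as codes of relations between two internal structures -/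

section Coding

variable {L : FirstOrder.Language.{0, 0}} {M : Type u} [setLang.Structure M] {X : Classes M}

theorem dfn_setMem : Dfn (setLang.sum (classLang X)) M
    (fun p : M × M => Structure.RelMap setMem ![p.1, p.2]) := by
  refine Dfn.of_definable (A := {v : Unit ⊕ Unit → M | Structure.RelMap setMem
    ![v (Sum.inl ()), v (Sum.inr ())]}) (Set.empty_definable_iff.2
      ⟨Relations.formula (L := setLang.sum (classLang X)) (Sum.inl setMem)
        ![Term.var (Sum.inl ()), Term.var (Sum.inr ())], ?_⟩) fun v => ?_
  · ext v
    refine Iff.trans ?_ (Formula.realize_rel (L := setLang.sum (classLang X)) (M := M)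
      (R := Sum.inl setMem) (v := v)).symm
    refine iff_of_eq (congrArg (Structure.RelMap setMem) ?_)
    ext i
    fin_cases i <;> rfl
  · constructor
    · rintro ⟨⟨x, y⟩, ⟨h1, h2⟩, h⟩
      obtain rfl : _ = x := h1
      obtain rfl : _ = y := h2
      exact h
    · exact fun h => ⟨(_, _), ⟨rfl, rfl⟩, h⟩

/-- The relation between internal structures coded by a set of pairs of representatives. -/
def codedRel (N₀ N₁ : InternalStructure L X) (m : M) (c : N₀.Carrier) (d : N₁.Carrier) : Prop :=
  ∃ z x y, Structure.RelMap setMem ![z, m] ∧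
    CodesPair (fun x y => Structure.RelMap setMem ![x, y]) z x y ∧
    N₀.Represents x c ∧ N₁.Represents y d

theorem isRelCode_codedRel (hX : IsSPCModel adjunctiveSetTheory M X)
    (N₀ N₁ : InternalStructure L X) :
    IsRelCode (setLang.sum (classLang X)) M (codedRel N₀ N₁) := by
  have hempty := realize_emptySetAx.1 (hX.realize_of_ofSentence_mem (Or.inl rfl))
  have hadj := realize_adjunctionAx.1 (hX.realize_of_ofSentence_mem (Or.inr rfl))
  refine ⟨?_, ?_, ?_⟩
  · have h1 := fun (Γ : Type u) [Coded (setLang.sum (classLang X)) M Γ] (f g : Γ → M) hf hg =>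
      (dfn_setMem (X := X)).comp₂ (f := f) (g := g)
        (P := fun x y => Structure.RelMap setMem ![x, y]) hf hg
    have h2 := fun (Γ : Type u) [Coded (setLang.sum (classLang X)) M Γ] (f : Γ → M) g hf hg =>
      (N₀.dfn_represents (L' := setLang)).comp₂ (f := f) (g := g) (P := N₀.Represents) hf hg
    have h3 := fun (Γ : Type u) [Coded (setLang.sum (classLang X)) M Γ] (f : Γ → M) g hf hg =>
      (N₁.dfn_represents (L' := setLang)).comp₂ (f := f) (g := g) (P := N₁.Represents) hf hg
    unfold codedRel CodesPair
    apply_rules (maxDepth := 1000) [h2, h3, h1, Dfn.eq, Dfn.and, Dfn.or, Dfn.iff, Dfn.all,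
      Dfn.ex, Tm.id, Tm.fst, Tm.snd]
  · obtain ⟨m, hm⟩ := hempty
    exact ⟨m, fun c d ⟨z, _, _, hz, _⟩ => hm z hz⟩
  · intro m c d
    obtain ⟨x, hx⟩ := N₀.exists_represents c
    obtain ⟨y, hy⟩ := N₁.exists_represents d
    obtain ⟨z, hz⟩ := exists_codesPair (e := fun x y => Structure.RelMap setMem ![x, y])
      hempty hadj x y
    -- One pair of representatives is adjoined. Since `z` determines `x` and `y`, and these
    -- determine `c` and `d`, no other pair enters the coded relation.
    obtain ⟨m', hm'⟩ := hadj m z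
    refine ⟨m', fun c' d' => ⟨?_, ?_⟩⟩
    · rintro ⟨z', x', y', h1, h2, h3, h4⟩
      rcases (hm' z').1 h1 with h1 | rfl
      · exact Or.inl ⟨z', x', y', h1, h2, h3, h4⟩
      · obtain ⟨rfl, rfl⟩ := h2.inj hz
        exact Or.inr ⟨h3.unique _ hx, h4.unique _ hy⟩
    · rintro (⟨z', x', y', h1, h2, h3, h4⟩ | ⟨rfl, rfl⟩)
      · exact ⟨z', x', y', (hm' z').2 (Or.inl h1), h2, h3, h4⟩
      · exact ⟨z, x, y, (hm' z).2 (Or.inr rfl), hz, hx, hy⟩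

end Coding

/-! ### The back-and-forth system of coded partial isomorphisms -/

theorem standaloneComplete_hf_DLO :
    StandaloneComplete.{u} (hf DLO) adjunctiveSetTheory := by
  intro M _ _ X hX N₀ N₁ hN₀ hN₁
  have h₀ := hN₀.isHF hX
  have h₁ := hN₁.isHF hX
  have hS := isRelCode_codedRel hX N₀ N₁
  refine elementarilyEquivalent_of_backAndForth
    {r | ∃ m, r = codedRel N₀ N₁ m ∧ IsPIso
      (fun x y : N₀.Carrier => Structure.RelMap (memS (L := ordLang)) ![x, y])
      (fun x => Structure.RelMap (atomS (L := ordLang)) ![x])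
      (fun x y => Structure.RelMap ltS ![x, y])
      (fun x y : N₁.Carrier => Structure.RelMap (memS (L := ordLang)) ![x, y])
      (fun x => Structure.RelMap (atomS (L := ordLang)) ![x])
      (fun x y => Structure.RelMap ltS ![x, y]) r} ?_ ?_ ?_ ?_ ?_
  · obtain ⟨m, hm⟩ := hS.empty
    exact ⟨_, m, rfl, isPIso_empty h₀ h₁ hm⟩
  · rintro r ⟨m, -, hr⟩ c d c' d' h h'
    exact ⟨fun e => hr.func c d d' h (e ▸ h'), fun e => hr.inj c c' d h (e ▸ h')⟩
  · rintro r ⟨m, -, hr⟩ n R v w hvw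
    have two : ∀ {C : Type u} (v : Fin 2 → C), v = ![v 0, v 1] := by
      intro C v
      ext i
      fin_cases i <;> rfl
    rcases R with R | R
    · cases R
      rw [two v, two w]
      exact hr.lt _ _ _ _ (hvw 0) (hvw 1)
    · cases R
      · rw [two v, two w]
        exact hr.mem _ _ _ _ (hvw 0) (hvw 1)
      · have one : ∀ {C : Type u} (v : Fin 1 → C), v = ![v 0] := by
          intro C v
          ext i
          fin_cases i
          rfl
        rw [one v, one w]
        exact hr.atom _ _ (hvw 0)
  · rintro r ⟨m, rfl, hr⟩ c
    obtain ⟨m', hm', hle, hd⟩ := hS.forth h₀ h₁ c m hr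
    exact ⟨_, ⟨m', rfl, hm'⟩, hle, hd⟩
  · rintro r ⟨m, rfl, hr⟩ d
    -- The back direction is the forth direction for the converse relations, with the induction now
    -- taking place in `N₁`.
    obtain ⟨m', hm', hle, hc⟩ := hS.symm.forth h₁ h₀ d m hr.symm
    exact ⟨_, ⟨m', rfl, hm'.symm⟩, fun x y => hle y x, hc⟩

end SchemeDef

theorem mainTheorem4 :
    SchemeDef.StandaloneComplete.{u} (SchemeDef.hf SchemeDef.DLO)
      SchemeDef.adjunctiveSetTheory := by
  exact SchemeDef.standaloneComplete_hf_DLO
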